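/- Let $G$ be a finite group and $h\in G$ an involution. Let $\widehat G$ be the (finite) set of irreducible complex representations of $G$ up to equivalence; for $\sigma\in\widehat G$ let $\chi_\sigma$ be its character and $d_\sigma$ its dimension, and put $\Lambda:=\{\sigma\in\widehat G : |\chi_\sigma(h)|=d_\sigma\}$. Suppose that $$|G|>\Big(\sum_{\sigma\in\Lambda}d_\sigma^2\Big)\Big(\sum_{\rho\in\widehat G}d_\rho\Big).$$ Then any efficient algorithm operating on coset states that distinguishes between the case when the hidden subgroup is a conjugate of $H_n:=\langle(h,\dots,h)\rangle\le G^n$ and the case when the hidden subgroup of $G^n$ is trivial needs measurements entangled across $\Omega(n)$ registers. Precisely: for a subgroup $K$ of a finite group $\Gamma$, the coset state is the density matrix $\sigma_K=\frac1{|\Gamma|}\sum_{g\in\Gamma}|gK\rangle\langle gK|$ on $\mathbb C[\Gamma]$, where $|gK\rangle=|K|^{-1/2}\sum_{x\in gK}|x\rangle$. An algorithm operating on coset states in $\Gamma$ performs finitely many steps; in each step it applies a POVM with finitely many outcomes jointly to some number $m\ge 0$ of fresh coset states, i.e. to the state $\sigma_K^{\otimes m}$ where $K$ is the hidden subgroup,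 and both $m$ and the POVM may depend on the outcomes observed so far; finally it accepts or rejects depending on the observed outcomes. The algorithm is $k$-entangled if $m\le k$ in every step, and it uses at most $t$ coset states if the numbers $m$ add up to at most $t$ in every run. It distinguishes the conjugates of $H$ from the trivial subgroup with advantage at least $\delta$ if, for every $g\in\Gamma$, its acceptance probability for the hidden subgroup $gHg^{-1}$ exceeds its acceptance probability for the trivial hidden subgroup by at least $\delta$. (Success probability at least $2/3$ in both cases gives advantage at least $1/3$.) There is a constant $c>0$, depending only on $G$ and $h$, such that for every integer $a\ge 0$ there is an $n_0$ with the following property for all $n\ge n_0$ and all $k\geq 0$: every $k$-entangled algorithm operating on coset states in $G^n$ that uses at most $n^a$ coset states (in particular, every such algorithm running in time at most $n^a$) and distinguishes the conjugates of $H_n$ from the trivial subgroup with advantage at least $n^{-a}$ satisfies $k\ge cn$. -/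

import Mathlib

open scoped BigOperators ComplexOrder

noncomputable section

namespace CosetStates

/-! ### Irreducible representations of a finite group -/

/-- The finite-dimensional irreducible complex representations of `G`, on coordinate spaces. -/
structure ConcreteIrrep (G : Type*) [Group G] where
  /-- the dimension -/
  dim : ℕ
  /-- the representation -/
  rep : Representation ℂ G (Fin dim → ℂ)
  irreducible : rep.IsIrreducible

/-- Equivalence (isomorphism) of irreducible representations. -/
def irrepSetoid (G : Type*) [Group G] : Setoid (ConcreteIrrep G) where
  r ρ σ := Nonempty (Representation.Equiv ρ.rep σ.rep)
  iseqv :=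
    { refl := fun ρ => ⟨Representation.Equiv.refl ρ.rep⟩
      symm := fun ⟨e⟩ => ⟨e.symm⟩
      trans := fun ⟨e⟩ ⟨f⟩ => ⟨e.trans f⟩ }

/-- The set `Ĝ` of irreducible complex representations of `G` up to equivalence. For finite `G`
every such representation is unitarizable, so these are also the classes of irreducible unitary
representations. -/
def Irrep (G : Type*) [Group G] : Type _ := Quotient (irrepSetoid G)

namespace Irrep

variable {G : Type*} [Group G]

/-- The class of an irreducible representation. -/
def mk (ρ : ConcreteIrrep G) : Irrep G := Quotient.mk (irrepSetoid G) ρ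

theorem mk_eq_mk {ρ τ : ConcreteIrrep G} :
    mk ρ = mk τ ↔ Nonempty (Representation.Equiv ρ.rep τ.rep) :=
  Quotient.eq

theorem exists_mk (σ : Irrep G) : ∃ ρ, mk ρ = σ := Quotient.exists_rep σ

/-- The dimension `d_σ`. -/
def dim (σ : Irrep G) : ℕ :=
  Quotient.lift (fun ρ : ConcreteIrrep G => ρ.dim)
    (fun ρ τ (hρτ : Nonempty (Representation.Equiv ρ.rep τ.rep)) => by
      obtain ⟨e⟩ := hρτ
      simpa using e.toLinearEquiv.finrank_eq) σ

/-- The character `χ_σ`. -/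
def character (σ : Irrep G) : G → ℂ :=
  Quotient.lift (fun ρ : ConcreteIrrep G => ρ.rep.character)
    (fun ρ τ (hρτ : Nonempty (Representation.Equiv ρ.rep τ.rep)) => by
      obtain ⟨e⟩ := hρτ
      exact Representation.char_iso e) σ

/-- A finite group has finitely many irreducible representations up to equivalence. -/
instance finite_irrep [Finite G] : Finite (Irrep G) := by
  classical
  have := Fintype.ofFinite G
  have hG : (Nat.card G : ℂ) ≠ 0 := by exact_mod_cast Nat.card_pos.ne'
  have : Invertible (Nat.card G : ℂ) := invertibleOfNonzero hG
  have horth : ∀ x y : Irrep G, (Nat.card G : ℂ)⁻¹ * ∑ g : G, x.character g * y.character g⁻¹ =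
      if x = y then 1 else 0 := by
    intro x y
    obtain ⟨ρ, rfl⟩ := exists_mk x
    obtain ⟨τ, rfl⟩ := exists_mk y
    have := ρ.irreducible
    have := τ.irreducible
    have heq : mk ρ = mk τ ↔ Nonempty (Representation.Equiv τ.rep ρ.rep) :=
      mk_eq_mk.trans ⟨fun ⟨e⟩ => ⟨e.symm⟩, fun ⟨e⟩ => ⟨e.symm⟩⟩
    simp only [heq]
    exact Representation.char_orthonormal ρ.rep τ.rep
  have hli : LinearIndependent ℂ (fun x : Irrep G => x.character) := by
    rw [linearIndependent_iff']
    intro s c hc y hy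
    have h1 : ∑ x ∈ s, c x *
        ((Nat.card G : ℂ)⁻¹ * ∑ g : G, x.character g * y.character g⁻¹) = 0 := by
      have h2 : ∀ g : G, ∑ x ∈ s, c x * x.character g = 0 := by
        intro g
        simpa using congrFun hc g
      calc _ = (Nat.card G : ℂ)⁻¹ * ∑ g : G, (∑ x ∈ s, c x * x.character g) *
              y.character g⁻¹ := by
            simp only [Finset.mul_sum, Finset.sum_mul]
            rw [Finset.sum_comm]
            refine Finset.sum_congr rfl fun g _ => Finset.sum_congr rfl fun x _ => ?_
            ring
        _ = 0 := by simp [h2]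
    simp only [horth] at h1
    simpa [hy] using h1
  exact hli.finite

instance fintype_irrep [Finite G] : Fintype (Irrep G) := Fintype.ofFinite _

end Irrep

/-- The set `Λ` of the irreducible representations `σ` with `|χ_σ(h)| = d_σ`. -/
def lambdaSet {G : Type*} [Group G] [Finite G] (h : G) : Finset (Irrep G) := by
  classical
  exact Finset.univ.filter fun σ : Irrep G => ‖σ.character h‖ = (σ.dim : ℝ)

/-! ### Coset states -/

section States

variable {Γ : Type*} [Group Γ] [Fintype Γ] [DecidableEq Γ]

/-- The vector `|gH⟩ = |H|^{-1/2} ∑_{x ∈ gH} |x⟩` of `ℂ[Γ]`, in the basis `Γ`. -/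
def cosetVec (H : Subgroup Γ) (g : Γ) : Γ → ℂ := by
  classical
  exact fun x => if g⁻¹ * x ∈ H then ((1 / Real.sqrt (Nat.card H) : ℝ) : ℂ) else 0

/-- The coset state `σ_H = |Γ|⁻¹ ∑_g |gH⟩⟨gH|`. -/
def cosetState (H : Subgroup Γ) : Matrix Γ Γ ℂ :=
  (Fintype.card Γ : ℂ)⁻¹ • ∑ g : Γ, Matrix.vecMulVec (cosetVec H g) (star (cosetVec H g))

/-- The state `σ_H^{⊗ m}` of `m` registers, on `ℂ[Γ]^{⊗ m} = ℂ[Γ^m]`. -/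
def cosetStatePow (H : Subgroup Γ) (m : ℕ) : Matrix (Fin m → Γ) (Fin m → Γ) ℂ :=
  Matrix.of fun x y => ∏ i, cosetState H (x i) (y i)

end States

/-- A POVM on `ℂ^I` with `r` outcomes. -/
structure POVM (I : Type*) [Fintype I] [DecidableEq I] (r : ℕ) where
  /-- the positive operator of each outcome -/
  elem : Fin r → Matrix I I ℂ
  posSemidef : ∀ i, (elem i).PosSemidef
  sum_eq_one : ∑ i, elem i = 1

/-- The Born rule: the probability of the outcome `i` in the state `s`. -/
def POVM.prob {I : Type*} [Fintype I] [DecidableEq I] {r : ℕ} (M : POVM I r)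
    (s : Matrix I I ℂ) (i : Fin r) : ℝ :=
  (Matrix.trace (M.elem i * s)).re

/-! ### Algorithms operating on coset states -/

/-- An adaptive algorithm operating on coset states in `Γ`: it either halts with a decision, where
`true` stands for a nontrivial hidden subgroup, or applies a POVM jointly to `m` fresh coset states
and continues depending on the observed outcome. A POVM on `m = 0` registers is a classical random
choice. -/
inductive CosetAlgorithm (Γ : Type*) [Fintype Γ] [DecidableEq Γ] where
  | halt (decision : Bool) : CosetAlgorithm Γ
  | measure (m r : ℕ) (M : POVM (Fin m → Γ) r) (next : Fin r → CosetAlgorithm Γ) :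
      CosetAlgorithm Γ

namespace CosetAlgorithm

variable {Γ : Type*} [Fintype Γ] [DecidableEq Γ]

/-- Every measurement of the algorithm acts jointly on at most `k` registers. -/
def IsEntangledAtMost (k : ℕ) : CosetAlgorithm Γ → Prop
  | halt _ => True
  | measure m _ _ next => m ≤ k ∧ ∀ i, (next i).IsEntangledAtMost k

/-- The largest total number of coset states used in a run of the algorithm. -/
def numStates : CosetAlgorithm Γ → ℕ
  | halt _ => 0
  | measure m _ _ next => m + Finset.univ.sup fun i => (next i).numStates

/-- The probability that the algorithm decides "nontrivial" when the hidden subgroup is `H`. -/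
def acceptProb [Group Γ] (H : Subgroup Γ) : CosetAlgorithm Γ → ℝ
  | halt b => if b then 1 else 0
  | measure m _ M next => ∑ i, M.prob (cosetStatePow H m) i * (next i).acceptProb H

/-- The algorithm distinguishes, with advantage at least `δ`, the case that the hidden subgroup is
a conjugate of `H` (whichever conjugate it is) from the case that it is trivial. -/
def Distinguishes [Group Γ] (A : CosetAlgorithm Γ) (H : Subgroup Γ) (δ : ℝ) : Prop :=
  ∀ g : Γ, A.acceptProb ⊥ + δ ≤ A.acceptProb (H.map (MulAut.conj g).toMonoidHom)

end CosetAlgorithm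

end CosetStates

end

noncomputable section

namespace CosetStates

/-! ### Completeness of the irreducible representations -/

/-! Let `K = conjProducts h`. The numerical hypothesis is used only to see that `K` is nonabelian
(`conjProducts_not_comm`). Representations trivial on `K` lie in `Λ`, so `[G : K] ≤ ∑_Λ d²`; if `K`
were abelian, every `d_ρ` would be at most `[G : K]`, and `|G| ≤ ∑ d_ρ² ≤ [G : K] ∑ d_ρ` would
contradict the hypothesis.

If `H = {1, t}`, the state of `m` registers is `|Γ|^{-m}` times the sum over sets `S` of registers
of the operator multiplying the registers in `S` by `t` on the right. The empty `S` gives the state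
of the trivial subgroup; every other `S` comes from a free action of `Γ = G^n`. After refining a
POVM to rank one elements `|b⟩⟨b|`, it remains to bound the correlations `⟨b, t b⟩` for `t` a random
conjugate of `(h, …, h)`, summed over the frame of all `b` (`exists_sum_corr_le`).

The second moment of a correlation is bounded by two operator inequalities, valid in all unitary
representations and stable under products of commuting copies (`exists_gap`, `average_pi_le`). The
first, applied to `b ⊗ b̄`, replaces conjugates of `h` by a lazy uniform element `κ` of `K`. Since
`|⟨b, κ b⟩|² = ⟨b, κ b⟩⟨b, κ⁻¹ b⟩`, the second applies to `b ⊗ b` under `(κ, κ⁻¹)` and leaves a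
correlation linear in `⟨b, c b⟩`, with `c` lazy uniform on `[K, K]` in each coordinate. Summed over
a frame of a free action, only `c = 1` survives, with weight `p^n`; here `p < 1` because `[K, K] ≠
1`. By Cauchy–Schwarz the correlations decay like `q^n`, `q = √p`.

There are at most `2^k` sets `S` per measurement. A hybrid argument over the adaptive steps bounds
the advantage by `numStates * 2^k * q^n` (`le_of_distinguishes`), which forces `k` to be linear in
`n`. -/

/-- A representation on `ℂ^d` whose operators span all matrices is irreducible. -/
theorem isIrreducible_of_surjective {G : Type*} [Group G] {d : ℕ} [NeZero d]
    (f : MonoidAlgebra ℂ G →ₐ[ℂ] Matrix (Fin d) (Fin d) ℂ) (hf : Function.Surjective f)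
    (ρ : Representation ℂ G (Fin d → ℂ))
    (hρ : ∀ g, ρ g = Matrix.toLinAlgEquiv' (f (MonoidAlgebra.of ℂ G g))) :
    ρ.IsIrreducible := by
  have hstab : ∀ (U : Subrepresentation ρ) (x : MonoidAlgebra ℂ G) (v : Fin d → ℂ),
      v ∈ U.toSubmodule → Matrix.toLinAlgEquiv' (f x) v ∈ U.toSubmodule := by
    intro U x v hv
    induction x using MonoidAlgebra.induction_on with
    | of g => rw [← hρ]; exact U.apply_mem_toSubmodule g hv
    | add x y hx hy => rw [map_add, map_add]; exact U.toSubmodule.add_mem hx hy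
    | smul c x hx => rw [map_smul, map_smul]; exact U.toSubmodule.smul_mem c hx
  have hnt : Nontrivial (Subrepresentation ρ) := by
    refine ⟨⊥, ⊤, fun h => ?_⟩
    have h1 : (⊥ : Submodule ℂ (Fin d → ℂ)) = ⊤ := congrArg Subrepresentation.toSubmodule h
    exact bot_ne_top h1
  refine { hnt with eq_bot_or_eq_top := fun U => ?_ }
  by_cases hU : U.toSubmodule = ⊥
  · exact Or.inl (Subrepresentation.toSubmodule_injective hU)
  · right
    obtain ⟨v, hv, hv0⟩ := Submodule.exists_mem_ne_zero_of_ne_bot hU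
    obtain ⟨i, hi⟩ := Function.ne_iff.mp hv0
    refine Subrepresentation.toSubmodule_injective ?_
    refine Submodule.eq_top_iff'.mpr fun w => ?_
    -- This rank one matrix sends `v` to the arbitrary vector `w`.
    obtain ⟨x, hx⟩ := hf (Matrix.vecMulVec w (Pi.single i (v i)⁻¹))
    have := hstab U x v hv
    rw [hx, Matrix.toLinAlgEquiv'_apply, Matrix.vecMulVec_mulVec] at this
    simpa [inv_mul_cancel₀ hi] using this

/-- By Wedderburn, `ℂ[G]` is a product of matrix algebras, and the projection to each factor is an
irreducible representation; an element killed by all of them is zero. -/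
theorem eq_zero_of_forall_irrep {G : Type*} [Group G] [Fintype G] (a : G → ℂ)
    (ha : ∀ ρ : ConcreteIrrep G, ∑ g, a g • ρ.rep g = 0) : a = 0 := by
  classical
  have : NeZero (Nat.card G : ℂ) := ⟨by exact_mod_cast Nat.card_pos.ne'⟩
  obtain ⟨n, d, hd, ⟨e⟩⟩ :=
    IsSemisimpleRing.exists_algEquiv_pi_matrix_of_isAlgClosed ℂ (MonoidAlgebra ℂ G)
  let x : MonoidAlgebra ℂ G := ∑ g, a g • MonoidAlgebra.of ℂ G g
  have hx : e x = 0 := by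
    funext i
    have := hd i
    let f : MonoidAlgebra ℂ G →ₐ[ℂ] Matrix (Fin (d i)) (Fin (d i)) ℂ :=
      (Pi.evalAlgHom ℂ (fun i => Matrix (Fin (d i)) (Fin (d i)) ℂ) i).comp e.toAlgHom
    have hf : Function.Surjective f := (Function.surjective_eval i).comp e.surjective
    let ρ : Representation ℂ G (Fin (d i) → ℂ) :=
      ((Matrix.toLinAlgEquiv' : Matrix (Fin (d i)) (Fin (d i)) ℂ ≃ₐ[ℂ] _) :
        Matrix (Fin (d i)) (Fin (d i)) ℂ →* _).comp
        ((f : MonoidAlgebra ℂ G →* _).comp (MonoidAlgebra.of ℂ G))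
    have h1 := ha ⟨d i, ρ, isIrreducible_of_surjective f hf ρ fun g => rfl⟩
    have h2 : Matrix.toLinAlgEquiv' (f x) = 0 := by
      rw [← h1]
      simp only [x, map_sum, map_smul]
      rfl
    have h3 : f x = 0 := (map_eq_zero_iff _ Matrix.toLinAlgEquiv'.injective).mp h2
    exact h3
  have hx0 : x = 0 := (map_eq_zero_iff _ e.injective).mp hx
  funext g
  have := congrArg (fun y : MonoidAlgebra ℂ G => y.coeff g) hx0
  simpa [x, Finsupp.single_apply, MonoidAlgebra.of_apply] using this

/-- If a normal subgroup has a nonzero fixed vector in an irreducible representation, then it acts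
trivially; otherwise its averaging operator vanishes. -/
theorem ConcreteIrrep.sum_normal_eq_zero {G : Type*} [Group G] (ρ : ConcreteIrrep G)
    (N : Subgroup G) [N.Normal] [Fintype N] (hN : ¬ ∀ κ ∈ N, ρ.rep κ = 1) :
    ∑ κ : N, ρ.rep (κ : G) = 0 := by
  have := ρ.irreducible
  let U : Subrepresentation ρ.rep :=
    { toSubmodule := ⨅ κ : N, LinearMap.eqLocus (ρ.rep (κ : G)) LinearMap.id
      apply_mem_toSubmodule := by
        intro g v hv
        simp only [Submodule.mem_iInf, LinearMap.mem_eqLocus, LinearMap.id_apply] at hv ⊢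
        intro κ
        have h1 := hv ⟨g⁻¹ * κ * g, by
          simpa using ‹N.Normal›.conj_mem κ κ.2 g⁻¹⟩
        have h2 : (κ : G) * g = g * (g⁻¹ * κ * g) := by group
        rw [← Module.End.mul_apply, ← map_mul, h2, map_mul, Module.End.mul_apply]
        exact congrArg _ h1 }
  rcases eq_bot_or_eq_top U with hU | hU
  · refine LinearMap.ext fun v => ?_
    have hmem : (∑ κ : N, ρ.rep (κ : G)) v ∈ U.toSubmodule := by
      simp only [U, Submodule.mem_iInf, LinearMap.mem_eqLocus, LinearMap.id_apply]
      intro κ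
      rw [← Module.End.mul_apply, Finset.mul_sum]
      congr 1
      simp only [← map_mul]
      exact Fintype.sum_equiv (Equiv.mulLeft κ) _ _ fun _ => rfl
    rw [hU] at hmem
    exact (Submodule.mem_bot ℂ).mp hmem
  · refine absurd (fun κ hκ => ?_) hN
    refine LinearMap.ext fun v => ?_
    have hv : v ∈ U.toSubmodule := by rw [hU]; exact Submodule.mem_top
    simp only [U, Submodule.mem_iInf, LinearMap.mem_eqLocus, LinearMap.id_apply] at hv
    exact hv ⟨κ, hκ⟩

/-- Functions on `G ⧸ N` embed into the product over `S` of the endomorphism algebras by `f ↦ ∑ f(g)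
ρ(g)`, because the representations nontrivial on `N` annihilate them anyway. The case of trivial `N`
gives `|G| ≤ ∑ d²`. -/
theorem index_le_sum_dim_sq {G : Type*} [Group G] [Fintype G] (N : Subgroup G) [N.Normal]
    (S : Finset (Irrep G))
    (hS : ∀ ρ : ConcreteIrrep G, (∀ κ ∈ N, ρ.rep κ = 1) → Irrep.mk ρ ∈ S) :
    N.index ≤ ∑ σ ∈ S, σ.dim ^ 2 := by
  classical
  choose r hr using (Irrep.exists_mk : ∀ σ : Irrep G, _)
  let Φ : (G ⧸ N → ℂ) →ₗ[ℂ] (∀ σ : S, Module.End ℂ (Fin (r σ).dim → ℂ)) :=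
    LinearMap.pi fun σ =>
      { toFun := fun f => ∑ g : G, f g • (r σ).rep g
        map_add' := by intro f f'; simp [add_smul, Finset.sum_add_distrib]
        map_smul' := by intro c f; simp [Finset.smul_sum, smul_smul] }
  have hinj : Function.Injective Φ := by
    rw [injective_iff_map_eq_zero]
    intro f hf
    have key : (fun g : G => f g) = 0 := by
      refine eq_zero_of_forall_irrep _ fun ρ => ?_
      by_cases hρ : ∀ κ ∈ N, ρ.rep κ = 1
      · have h1 : ∑ g : G, f g • (r (Irrep.mk ρ)).rep g = 0 := congrFun hf ⟨Irrep.mk ρ, hS ρ hρ⟩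
        obtain ⟨E⟩ := Irrep.mk_eq_mk.mp (hr (Irrep.mk ρ))
        refine LinearMap.ext fun v => ?_
        obtain ⟨w, rfl⟩ := E.toLinearEquiv.surjective v
        have h2 := congrArg E.toLinearEquiv (LinearMap.congr_fun h1 w)
        simp only [LinearMap.sum_apply, LinearMap.smul_apply, map_sum, map_smul,
          LinearMap.zero_apply, map_zero] at h2 ⊢
        rw [← h2]
        refine Finset.sum_congr rfl fun g _ => ?_
        congr 1
        exact (E.toIntertwiningMap.isIntertwining _ _ g w).symm
      -- As `f` is constant on cosets, `∑ f(g) ρ(g)` absorbs `ρ(κ)` on the right, hence is a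
      -- multiple of its product with `∑ ρ(κ) = 0`.
      · have h0 := ρ.sum_normal_eq_zero N hρ
        have h1 : ∀ κ : N, ∑ g : G, f g • ρ.rep g * ρ.rep κ = ∑ g : G, f g • ρ.rep g := by
          intro κ
          refine Fintype.sum_equiv (Equiv.mulRight (κ : G)) _ _ fun g => ?_
          have h3 : ((g * κ : G) : G ⧸ N) = (g : G ⧸ N) := by
            rw [QuotientGroup.eq]; simp
          simp [h3]
        have h2 : (Fintype.card N : ℂ) • ∑ g : G, f g • ρ.rep g = 0 := by
          calc (Fintype.card N : ℂ) • ∑ g : G, f g • ρ.rep g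
              = ∑ κ : N, ∑ g : G, f g • ρ.rep g * ρ.rep κ := by
                simp only [h1, Finset.sum_const, Finset.card_univ]
                rw [Nat.cast_smul_eq_nsmul]
            _ = (∑ g : G, f g • ρ.rep g) * ∑ κ : N, ρ.rep (κ : G) := by
                rw [Finset.sum_comm, Finset.sum_mul]
                simp only [Finset.mul_sum]
            _ = 0 := by rw [h0, mul_zero]
        exact (smul_eq_zero.mp h2).resolve_left (by exact_mod_cast Fintype.card_ne_zero)
    funext x
    obtain ⟨g, rfl⟩ := QuotientGroup.mk_surjective x
    exact congrFun key g
  have hle := LinearMap.finrank_le_finrank_of_injective hinj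
  rw [Module.finrank_fintype_fun_eq_card, Module.finrank_pi_fintype] at hle
  have hdim : ∀ σ : Irrep G, (r σ).dim = σ.dim := fun σ => by
    conv_rhs => rw [← hr σ]
    rfl
  rw [Subgroup.index, Nat.card_eq_fintype_card]
  refine hle.trans (le_of_eq ?_)
  rw [← Finset.sum_coe_sort S]
  refine Finset.sum_congr rfl fun σ _ => ?_
  simp [Module.finrank_linearMap, hdim, sq]

/-- An abelian subgroup bounds the dimensions of the irreducible representations by its index. -/
theorem ConcreteIrrep.dim_le_index {G : Type*} [Group G] [Fintype G] (ρ : ConcreteIrrep G)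
    (N : Subgroup G) (hN : ∀ a ∈ N, ∀ b ∈ N, a * b = b * a) : ρ.dim ≤ N.index := by
  classical
  have := ρ.irreducible
  have hdim : Nontrivial (Fin ρ.dim → ℂ) := by
    by_contra hn
    rw [not_nontrivial_iff_subsingleton] at hn
    have : (⊥ : Subrepresentation ρ.rep) = ⊤ :=
      Subrepresentation.toSubmodule_injective (Subsingleton.elim _ _)
    exact bot_ne_top this
  obtain ⟨χ, v, hv0, hv⟩ : ∃ (χ : N → ℂ) (v : Fin ρ.dim → ℂ), v ≠ 0 ∧
      ∀ κ : N, ρ.rep κ v = χ κ • v := by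
    have : IsMulCommutative N := ⟨⟨fun a b => Subtype.ext (hN a a.2 b b.2)⟩⟩
    have hscal : ∀ (τ : ConcreteIrrep N) (κ : N), ∃ c : ℂ, τ.rep κ = c • LinearMap.id := by
      intro τ κ
      have := τ.irreducible
      have h1 := Representation.IsIrreducible.finrank_eq_one_of_isMulCommutative τ.rep
      obtain ⟨c, hc, -⟩ := LinearMap.existsUnique_eq_smul_id_of_finrank_eq_one h1 (τ.rep κ)
      exact ⟨c, hc⟩
    choose c hc using hscal
    obtain ⟨v, hv⟩ := exists_ne (0 : Fin ρ.dim → ℂ)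
    by_contra! hcon
    -- The projection of `v` to the isotypic part of a character of `N` is fixed up to scalars by
    -- `N`, so without common eigenvectors all these projections vanish; completeness of the
    -- characters then gives `v = 0`.
    have hzero : ∀ τ : ConcreteIrrep N, ∑ κ : N, c τ κ • ρ.rep (κ : G)⁻¹ v = 0 := by
      intro τ
      by_contra hne
      obtain ⟨l, hl⟩ := hcon (c τ) _ hne
      refine hl ?_
      rw [map_sum, Finset.smul_sum]
      refine Fintype.sum_equiv (Equiv.mulRight l⁻¹) _ _ fun κ => ?_
      rw [map_smul, ← Module.End.mul_apply, ← map_mul, smul_smul]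
      have h2 : c τ l * c τ (κ * l⁻¹) = c τ κ := by
        have := τ.irreducible
        have h1 := Representation.IsIrreducible.finrank_eq_one_of_isMulCommutative τ.rep
        obtain ⟨u, hu, -⟩ := finrank_eq_one_iff'.mp h1
        have h3 : τ.rep (κ * l⁻¹ * l) u = τ.rep κ u := by rw [inv_mul_cancel_right]
        rw [map_mul, Module.End.mul_apply] at h3
        simp only [hc, LinearMap.smul_apply, LinearMap.id_apply, smul_smul] at h3
        rw [mul_comm]
        exact smul_left_injective ℂ hu h3
      have h4 : ((Equiv.mulRight l⁻¹ κ : N) : G)⁻¹ = l * (κ : G)⁻¹ := by simp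
      rw [h4, Equiv.coe_mulRight, h2]
    refine hv (funext fun i => ?_)
    have h0 := eq_zero_of_forall_irrep (fun κ : N => ρ.rep (κ : G)⁻¹ v i) fun τ => by
      have h1 := congrFun (hzero τ) i
      simp only [Finset.sum_apply, Pi.smul_apply, smul_eq_mul, Pi.zero_apply] at h1
      simp only [hc, smul_smul]
      rw [← Finset.sum_smul]
      simp only [mul_comm _ (c τ _)]
      rw [h1, zero_smul]
    simpa using congrFun h0 1
  -- The translates of the eigenvector `v` by coset representatives span an invariant subspace,
  -- hence everything.
  let s : G ⧸ N → (Fin ρ.dim → ℂ) := fun x => ρ.rep x.out v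
  let U : Subrepresentation ρ.rep :=
    { toSubmodule := Submodule.span ℂ (Set.range s)
      apply_mem_toSubmodule := by
        intro g w hw
        refine Submodule.span_induction (p := fun w _ => ρ.rep g w ∈ Submodule.span ℂ (Set.range s))
          ?_ (by simp) (fun x y _ _ hx hy => by rw [map_add]; exact Submodule.add_mem _ hx hy)
          (fun c x _ hx => by rw [map_smul]; exact Submodule.smul_mem _ c hx) hw
        rintro _ ⟨x, rfl⟩
        obtain ⟨κ, hκ⟩ := QuotientGroup.mk_out_eq_mul N (g * x.out)
        have h1 : g * x.out = ((g * x.out : G) : G ⧸ N).out * (κ : G)⁻¹ := by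
          rw [hκ]; group
        have h2 : ρ.rep g (s x) = χ κ⁻¹ • s ((g * x.out : G) : G ⧸ N) := by
          change ρ.rep g (ρ.rep x.out v) = _
          have h3 := hv κ⁻¹
          rw [Subgroup.coe_inv] at h3
          rw [← Module.End.mul_apply, ← map_mul]
          conv_lhs => rw [h1]
          rw [map_mul, Module.End.mul_apply, h3, map_smul]
        rw [h2]
        exact Submodule.smul_mem _ _ (Submodule.subset_span ⟨_, rfl⟩) }
  have hU : U = ⊤ := by
    refine (eq_bot_or_eq_top U).resolve_left fun hU => hv0 ?_
    have h1 : s ((1 : G) : G ⧸ N) ∈ U.toSubmodule := Submodule.subset_span ⟨_, rfl⟩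
    rw [hU] at h1
    have h2 : ρ.rep ((1 : G) : G ⧸ N).out v = 0 := (Submodule.mem_bot ℂ).mp h1
    have h3 := congrArg (ρ.rep (((1 : G) : G ⧸ N).out)⁻¹) h2
    rwa [← Module.End.mul_apply, ← map_mul, inv_mul_cancel, map_one, map_zero] at h3
  have hspan : Submodule.span ℂ (Set.range s) = ⊤ := congrArg Subrepresentation.toSubmodule hU
  have h4 := finrank_range_le_card (R := ℂ) s
  rw [Set.finrank, hspan, finrank_top] at h4
  rw [Subgroup.index, Nat.card_eq_fintype_card]
  simpa using h4

/-- The subgroup generated by the products of two conjugates of `h`. -/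
def conjProducts {G : Type*} [Group G] (h : G) : Subgroup G :=
  Subgroup.closure {z | ∃ x y : G, z = x * h * x⁻¹ * (y * h * y⁻¹)}

instance conjProducts_normal {G : Type*} [Group G] (h : G) : (conjProducts h).Normal := by
  refine ⟨fun n hn g => ?_⟩
  refine Subgroup.closure_induction (p := fun n _ => g * n * g⁻¹ ∈ conjProducts h) ?_ (by simp [one_mem])
    (fun a b _ _ ha hb => ?_) (fun a _ ha => ?_) hn
  · rintro _ ⟨x, y, rfl⟩
    exact Subgroup.subset_closure ⟨g * x, g * y, by group⟩
  · have : g * (a * b) * g⁻¹ = (g * a * g⁻¹) * (g * b * g⁻¹) := by group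
    rw [this]; exact mul_mem ha hb
  · have : g * a⁻¹ * g⁻¹ = (g * a * g⁻¹)⁻¹ := by group
    rw [this]; exact inv_mem ha

/-- Triviality on products of two conjugates makes `ρ(h)` equal to all its conjugates, since `ρ(h)²
= 1`. It is then central, by Schur a scalar, and its square is `1`. -/
theorem mk_mem_lambdaSet {G : Type*} [Group G] [Finite G] {h : G} (h_inv : orderOf h = 2)
    (ρ : ConcreteIrrep G) (hρ : ∀ κ ∈ conjProducts h, ρ.rep κ = 1) :
    Irrep.mk ρ ∈ lambdaSet h := by
  have := ρ.irreducible
  have hh : h * h = 1 := by rw [← sq, ← h_inv, pow_orderOf_eq_one]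
  have hsq : ρ.rep h * ρ.rep h = 1 := by rw [← map_mul, hh, map_one]
  have hcomm : ∀ g, ρ.rep h * ρ.rep g = ρ.rep g * ρ.rep h := by
    intro g
    have h1 : ρ.rep (1 * h * 1⁻¹ * (g * h * g⁻¹)) = 1 :=
      hρ _ (Subgroup.subset_closure ⟨1, g, rfl⟩)
    rw [one_mul, inv_one, mul_one, map_mul] at h1
    have h2 : ρ.rep (g * h * g⁻¹) = ρ.rep h := by
      rw [← mul_one (ρ.rep h), ← h1, ← mul_assoc, hsq, one_mul]
    conv_lhs => rw [← h2]
    rw [← map_mul, ← map_mul, inv_mul_cancel_right]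
  let T : Representation.IntertwiningMap ρ.rep ρ.rep :=
    { toLinearMap := ρ.rep h
      isIntertwining' := fun g => hcomm g }
  obtain ⟨c, hc⟩ :=
    Representation.IsIrreducible.algebraMap_intertwiningMap_bijective_of_isAlgClosed.2 T
  have hc' : ρ.rep h = c • LinearMap.id :=
    (congrArg Representation.IntertwiningMap.toLinearMap hc).symm
  have hnorm : ‖(c : ℂ)‖ = 1 ∨ ρ.dim = 0 := by
    rcases Nat.eq_zero_or_pos ρ.dim with h0 | hpos
    · exact Or.inr h0
    left
    have h1 := congrFun (LinearMap.congr_fun hsq (Pi.single ⟨0, hpos⟩ 1)) ⟨0, hpos⟩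
    rw [hc'] at h1
    simp at h1
    have h2 : ‖c‖ * ‖c‖ = 1 := by rw [← norm_mul, h1, norm_one]
    nlinarith [norm_nonneg c]
  have hχ : ‖ρ.rep.character h‖ = ρ.dim := by
    rw [Representation.character, hc', map_smul, LinearMap.trace_id]
    rcases hnorm with h1 | h1 <;> simp [h1]
  simp only [lambdaSet, Finset.mem_filter, Finset.mem_univ, true_and]
  exact hχ

/-- The hypothesis of the main theorem forces the subgroup generated by the products of two
conjugates of `h` to be nonabelian. -/
theorem conjProducts_not_comm {G : Type*} [Group G] [Fintype G] {h : G} (h_inv : orderOf h = 2)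
    (hG : (∑ σ ∈ lambdaSet h, σ.dim ^ 2) * (∑ ρ : Irrep G, ρ.dim) < Fintype.card G) :
    ∃ a ∈ conjProducts h, ∃ b ∈ conjProducts h, a * b ≠ b * a := by
  classical
  by_contra! hcomm
  have h1 := index_le_sum_dim_sq (conjProducts h) (lambdaSet h) (mk_mem_lambdaSet h_inv)
  have h2 := index_le_sum_dim_sq (⊥ : Subgroup G) Finset.univ (fun _ _ => Finset.mem_univ _)
  rw [Subgroup.index_bot, Nat.card_eq_fintype_card] at h2
  -- One factor of each `d_σ²` is bounded by the index of the abelian subgroup, the other is kept.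
  have h3 : ∑ σ : Irrep G, σ.dim ^ 2 ≤ (conjProducts h).index * ∑ σ : Irrep G, σ.dim := by
    rw [Finset.mul_sum]
    refine Finset.sum_le_sum fun σ _ => ?_
    obtain ⟨ρ, rfl⟩ := Irrep.exists_mk σ
    rw [sq]
    exact Nat.mul_le_mul_right _ (ρ.dim_le_index _ hcomm)
  have h4 := Nat.mul_le_mul_right (∑ σ : Irrep G, σ.dim) h1
  omega

/-! ### Averages of unitary representations -/

section Gap

universe u v

variable {Δ : Type u} [Group Δ] {A : Type v} [CStarAlgebra A]

/-- The scalar `s` is a sign. Both signs are carried throughout, since multiplying operator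
inequalities needs the two-sided bound `± a ≤ b`. -/
theorem star_one_sub_smul_mul_self (π : Δ →* A) (hπ : ∀ g, star (π g) = π g⁻¹) (a : Δ) {s : ℝ}
    (hs : s * s = 1) :
    star (1 - s • π a) * (1 - s • π a) = (2 : ℝ) • (1 : A) - s • π a - s • π a⁻¹ := by
  have ha : π a⁻¹ * π a = 1 := by rw [← map_mul, inv_mul_cancel, map_one]
  rw [star_sub, star_one, star_smul, star_trivial s, hπ, sub_mul, mul_sub, mul_sub,
    smul_mul_smul_comm, ha, hs, two_smul, one_smul]
  simp only [one_mul, mul_one]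
  abel

variable {I : Type*} [Fintype I]

/-- The average of a representation with respect to a weighted family of group elements. -/
def average (w : I → ℝ) (y : I → Δ) (π : Δ →* A) : A := ∑ i, w i • π (y i)

/-- The mixture of the point mass at `1` and of the uniform distribution on a finite group. -/
def lazyWeight (L : Type*) [Group L] [Fintype L] (η : ℝ) (κ : L) : ℝ := by
  classical
  exact (if κ = 1 then 1 - η else 0) + η / Fintype.card L

open Classical in
theorem average_lazyWeight {L : Type*} [Group L] [Fintype L] (j : L →* Δ) (η : ℝ) (π : Δ →* A) :
    average (lazyWeight L η) j π =
      (1 - η) • (1 : A) + (η / Fintype.card L) • ∑ κ : L, π (j κ) := by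
  have h1 : ∀ κ : L, lazyWeight L η κ • π (j κ) =
      (Pi.single (M := fun _ => A) 1 ((1 - η) • (1 : A)) : L → A) κ +
        (η / Fintype.card L) • π (j κ) := fun κ => by
    by_cases hκ : κ = 1 <;> simp [lazyWeight, hκ, add_smul]
  simp only [average, h1, Finset.sum_add_distrib, Finset.smul_sum,
    Finset.sum_pi_single', Finset.mem_univ, if_true]

/-- A family of group elements with positive weights of total mass one, stable under inversion. -/
structure IsSymmetricWeight (w : I → ℝ) (y : I → Δ) : Prop where
  pos : ∀ i, 0 < w i
  sum_eq_one : ∑ i, w i = 1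
  symm : ∃ e : I ≃ I, ∀ i, y (e i) = (y i)⁻¹ ∧ w (e i) = w i

/-- This is the Dirichlet form of the random walk, with sign `s`; symmetry merges the terms of `y i`
and `(y i)⁻¹`. -/
theorem IsSymmetricWeight.sum_star_mul_self {w : I → ℝ} {y : I → Δ} (hw : IsSymmetricWeight w y)
    (π : Δ →* A) (hπ : ∀ g, star (π g) = π g⁻¹) {s : ℝ} (hs : s * s = 1) :
    ∑ i, w i • (star (1 - s • π (y i)) * (1 - s • π (y i))) =
      (2 : ℝ) • (1 - s • average w y π) := by
  obtain ⟨e, he⟩ := hw.symm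
  have h1 : ∑ i, w i • π (y i)⁻¹ = average w y π := by
    refine Fintype.sum_equiv e _ _ fun i => ?_
    rw [(he i).1, (he i).2]
  have h2 : ∀ i, w i • (star (1 - s • π (y i)) * (1 - s • π (y i))) =
      w i • (2 : ℝ) • (1 : A) - s • w i • π (y i) - s • w i • π (y i)⁻¹ := fun i => by
    rw [star_one_sub_smul_mul_self π hπ _ hs, smul_sub, smul_sub, smul_comm (w i) s,
      smul_comm (w i) s]
  simp only [h2, Finset.sum_sub_distrib]
  rw [← Finset.smul_sum, ← Finset.smul_sum, h1, ← Finset.sum_smul, hw.sum_eq_one, ← average,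
    one_smul, smul_sub, two_smul ℝ (s • average w y π)]
  abel

theorem average_commute {Δ' J : Type*} [Group Δ'] [Fintype J] {π : Δ →* A} {π' : Δ' →* A}
    (hcomm : ∀ a b, Commute (π a) (π' b)) (w : I → ℝ) (y : I → Δ) (w' : J → ℝ) (y' : J → Δ') :
    Commute (average w y π) (average w' y' π') :=
  Commute.sum_left _ _ _ fun _ _ => Commute.sum_right _ _ _ fun _ _ =>
    ((hcomm _ _).smul_left _).smul_right _

/-- The inclusion of `Δ^n` in `Δ^(n+1)` as the last `n` coordinates. -/
def consOneHom (Δ : Type*) [Group Δ] (n : ℕ) : (Fin n → Δ) →* (Fin (n + 1) → Δ) where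
  toFun γ := Fin.cons 1 γ
  map_one' := by ext k; refine Fin.cases ?_ (fun k => ?_) k <;> simp
  map_mul' a b := by ext k; refine Fin.cases ?_ (fun k => ?_) k <;> simp

theorem average_cons (n : ℕ) (w : I → ℝ) (y : I → Δ) (π : (Fin (n + 1) → Δ) →* A) :
    average (fun i : Fin (n + 1) → I => ∏ k, w (i k)) (fun i k => y (i k)) π =
      average w y (π.comp (MonoidHom.mulSingle (fun _ : Fin (n + 1) => Δ) 0)) *
        average (fun i : Fin n → I => ∏ k, w (i k)) (fun i k => y (i k))
          (π.comp (consOneHom Δ n)) := by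
  unfold average
  rw [Finset.sum_mul_sum, ← Fintype.sum_prod_type']
  refine (Fintype.sum_equiv (Fin.consEquiv fun _ => I) _ _ fun p => ?_).symm
  rw [smul_mul_smul_comm]
  congr 1
  · simp [Fin.prod_univ_succ, Fin.consEquiv]
  rw [MonoidHom.comp_apply, MonoidHom.comp_apply, ← map_mul]
  congr 1
  ext k
  refine Fin.cases ?_ (fun k => ?_) k <;> simp [Fin.consEquiv, consOneHom]

variable [PartialOrder A] [StarOrderedRing A]

theorem star_add_mul_add_le (a b : A) :
    star (a + b) * (a + b) ≤ (2 : ℝ) • (star a * a) + (2 : ℝ) • (star b * b) := by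
  have h := star_mul_self_nonneg (a - b)
  rw [← sub_nonneg]
  convert h using 1
  simp only [star_add, star_sub, two_smul]
  noncomm_ring

/-- The sign cancels in a product of two elements: `1 - π(ab) = (1 - sπ(a)) + sπ(a)(1 - sπ(b))`. -/
theorem star_one_sub_mul_le (π : Δ →* A) (hπ : ∀ g, star (π g) = π g⁻¹) (a b : Δ) {s : ℝ}
    (hs : s * s = 1) :
    star (1 - π (a * b)) * (1 - π (a * b)) ≤
      (2 : ℝ) • (star (1 - s • π a) * (1 - s • π a)) +
      (2 : ℝ) • (star (1 - s • π b) * (1 - s • π b)) := by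
  have ha : star (π a) * π a = 1 := by rw [hπ, ← map_mul, inv_mul_cancel, map_one]
  have h1 : 1 - π (a * b) = (1 - s • π a) + s • π a * (1 - s • π b) := by
    rw [mul_sub, mul_one, smul_mul_smul_comm, hs, one_smul, map_mul]
    abel
  have h2 : star (s • π a * (1 - s • π b)) * (s • π a * (1 - s • π b)) =
      star (1 - s • π b) * (1 - s • π b) := by
    rw [star_mul, star_smul, star_trivial s, mul_assoc, ← mul_assoc (s • star (π a)),
      smul_mul_smul_comm, hs, one_smul, ha, one_mul]
  rw [h1, ← h2]
  exact star_add_mul_add_le _ _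

theorem IsSymmetricWeight.one_sub_nonneg {w : I → ℝ} {y : I → Δ} (hw : IsSymmetricWeight w y)
    (π : Δ →* A) (hπ : ∀ g, star (π g) = π g⁻¹) {s : ℝ} (hs : s * s = 1) :
    0 ≤ 1 - s • average w y π := by
  have h1 : 0 ≤ (2 : ℝ) • (1 - s • average w y π) := by
    rw [← hw.sum_star_mul_self π hπ hs]
    exact Finset.sum_nonneg fun i _ => smul_nonneg (hw.pos i).le (star_mul_self_nonneg _)
  have h2 := smul_nonneg (by norm_num : (0 : ℝ) ≤ 1 / 2) h1
  rwa [smul_smul, one_div, inv_mul_cancel₀ two_ne_zero, one_smul] at h2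

theorem IsSymmetricWeight.star_one_sub_le {w : I → ℝ} {y : I → Δ} (hw : IsSymmetricWeight w y)
    (π : Δ →* A) (hπ : ∀ g, star (π g) = π g⁻¹) {s : ℝ} (hs : s * s = 1) (i : I) :
    star (1 - s • π (y i)) * (1 - s • π (y i)) ≤ (2 / w i) • (1 - s • average w y π) := by
  have h1 : w i • (star (1 - s • π (y i)) * (1 - s • π (y i))) ≤
      (2 : ℝ) • (1 - s • average w y π) := by
    rw [← hw.sum_star_mul_self π hπ hs]
    exact Finset.single_le_sum
      (f := fun i => w i • (star (1 - s • π (y i)) * (1 - s • π (y i))))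
      (fun i _ => smul_nonneg (hw.pos i).le (star_mul_self_nonneg _)) (Finset.mem_univ i)
  have h2 := smul_le_smul_of_nonneg_left h1 (inv_pos.mpr (hw.pos i)).le
  rwa [smul_smul, smul_smul, inv_mul_cancel₀ (hw.pos i).ne', one_smul, inv_mul_eq_div] at h2

/-- The displacement by one `y i` is controlled by the Dirichlet form, and displacements add up
along words. Products of pairs are required as generators so that both signs `s` are covered. The
constant depends on neither the algebra nor the representation. -/
theorem IsSymmetricWeight.exists_const {w : I → ℝ} {y : I → Δ} (hw : IsSymmetricWeight w y)
    {κ : Δ} (hκ : κ ∈ Subgroup.closure {z | ∃ i j, z = y i * y j}) :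
    ∃ c : ℝ, 0 ≤ c ∧ ∀ (A : Type v) [CStarAlgebra A] [PartialOrder A] [StarOrderedRing A]
      (π : Δ →* A) (_ : ∀ g, star (π g) = π g⁻¹) (s : ℝ) (_ : s * s = 1),
      star (1 - π κ) * (1 - π κ) ≤ c • (1 - s • average w y π) := by
  refine Subgroup.closure_induction (p := fun κ _ => ∃ c : ℝ, 0 ≤ c ∧
    ∀ (A : Type v) [CStarAlgebra A] [PartialOrder A] [StarOrderedRing A]
      (π : Δ →* A) (_ : ∀ g, star (π g) = π g⁻¹) (s : ℝ) (_ : s * s = 1),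
      star (1 - π κ) * (1 - π κ) ≤ c • (1 - s • average w y π)) ?_ ?_ ?_ ?_ hκ
  · rintro _ ⟨i, j, rfl⟩
    refine ⟨2 * (2 / w i) + 2 * (2 / w j), ?_, ?_⟩
    · have := hw.pos i
      have := hw.pos j
      positivity
    · intro A _ _ _ π hπ s hs
      refine (star_one_sub_mul_le π hπ _ _ hs).trans ?_
      rw [add_smul, mul_smul, mul_smul]
      exact add_le_add
        (smul_le_smul_of_nonneg_left (hw.star_one_sub_le π hπ hs i) (by norm_num))
        (smul_le_smul_of_nonneg_left (hw.star_one_sub_le π hπ hs j) (by norm_num))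
  · exact ⟨0, le_rfl, fun A _ _ _ π hπ s hs => by simp⟩
  · rintro a b - - ⟨c, hc, h⟩ ⟨d, hd, k⟩
    refine ⟨2 * c + 2 * d, by positivity, fun A _ _ _ π hπ s hs => ?_⟩
    refine (star_one_sub_mul_le π hπ _ _ (one_mul (1 : ℝ))).trans ?_
    rw [add_smul, mul_smul, mul_smul, one_smul, one_smul]
    exact add_le_add (smul_le_smul_of_nonneg_left (h A π hπ s hs) (by norm_num))
      (smul_le_smul_of_nonneg_left (k A π hπ s hs) (by norm_num))
  · rintro a - ⟨c, hc, h⟩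
    refine ⟨c, hc, fun A _ _ _ π hπ s hs => ?_⟩
    have h1 := h A π hπ s hs
    have h2 := star_one_sub_smul_mul_self π hπ a (one_mul (1 : ℝ))
    have h3 := star_one_sub_smul_mul_self π hπ a⁻¹ (one_mul (1 : ℝ))
    simp only [one_smul, inv_inv] at h2 h3
    rwa [h3, sub_right_comm, ← h2]

theorem lazyWeight_pos (L : Type*) [Group L] [Fintype L] {η : ℝ} (h0 : 0 < η) (h1 : η ≤ 1)
    (κ : L) : 0 < lazyWeight L η κ := by
  have : (0 : ℝ) < Fintype.card L := by exact_mod_cast Fintype.card_pos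
  unfold lazyWeight
  have h2 : 0 < η / Fintype.card L := by positivity
  split_ifs <;> linarith

open Classical in
theorem sum_lazyWeight (L : Type*) [Group L] [Fintype L] (η : ℝ) :
    ∑ κ, lazyWeight L η κ = 1 := by
  have : (Fintype.card L : ℝ) ≠ 0 := by exact_mod_cast Fintype.card_ne_zero
  have h1 : ∑ κ : L, (if κ = 1 then 1 - η else 0) = 1 - η := by simp
  rw [← sub_add_cancel 1 η, ← h1]
  simp only [lazyWeight, Finset.sum_add_distrib, Finset.sum_const, Finset.card_univ, nsmul_eq_mul,
    mul_div_cancel₀ _ this]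

theorem lazyWeight_inv (L : Type*) [Group L] [Fintype L] (η : ℝ) (κ : L) :
    lazyWeight L η κ⁻¹ = lazyWeight L η κ := by
  by_cases h : κ = 1 <;> simp [lazyWeight, h]

/-- A Poincaré-type comparison: averaging the displacement bounds over `L` gives `η (1 - P) ≤ 1 - s
• average w y π`, where `P` is the projection to the `L`-invariants. -/
theorem IsSymmetricWeight.exists_gap {w : I → ℝ} {y : I → Δ} (hw : IsSymmetricWeight w y)
    {L : Type*} [Group L] [Fintype L] (j : L →* Δ)
    (hL : ∀ κ, j κ ∈ Subgroup.closure {z | ∃ i j, z = y i * y j}) :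
    ∃ η : ℝ, 0 < η ∧ η ≤ 1 ∧
      ∀ (A : Type v) [CStarAlgebra A] [PartialOrder A] [StarOrderedRing A]
        (π : Δ →* A) (_ : ∀ g, star (π g) = π g⁻¹) (s : ℝ) (_ : s * s = 1),
        s • average w y π ≤ average (lazyWeight L η) j π := by
  choose c hc0 hc using fun κ : L => hw.exists_const.{u, v} (hL κ)
  set c' : ℝ := 2 + ∑ κ, c κ with hc'
  have hcκ : ∀ κ, c κ ≤ c' := fun κ => by
    have := Finset.single_le_sum (fun κ _ => hc0 κ) (Finset.mem_univ κ)
    linarith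
  have hc1 : 2 ≤ c' := by
    have := Finset.sum_nonneg fun κ (_ : κ ∈ Finset.univ) => hc0 κ
    linarith
  have hcard : (Fintype.card L : ℝ) ≠ 0 := by exact_mod_cast Fintype.card_ne_zero
  have hc'0 : 0 < c' := by linarith
  -- The numerator `2` comes from `|1 - π(κ)|² = 2 - π(κ) - π(κ)⁻¹`; the summand `2` in `c'` keeps
  -- `η ≤ 1`.
  refine ⟨2 / c', by positivity, (div_le_one hc'0).mpr hc1, fun A _ _ _ π hπ s hs => ?_⟩
  have hn := hw.one_sub_nonneg π hπ hs
  have h1 : ∀ κ : L, (2 : ℝ) • (1 : A) - π (j κ) - π (j κ)⁻¹ ≤ c' • (1 - s • average w y π) := by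
    intro κ
    have h2 := star_one_sub_smul_mul_self π hπ (j κ) (one_mul (1 : ℝ))
    simp only [one_smul] at h2
    rw [← h2]
    exact (hc κ A π hπ s hs).trans (smul_le_smul_of_nonneg_right (hcκ κ) hn)
  have h3 := Finset.sum_le_sum fun κ (_ : κ ∈ (Finset.univ : Finset L)) => h1 κ
  have h4 : ∑ κ : L, π (j κ)⁻¹ = ∑ κ : L, π (j κ) :=
    Fintype.sum_equiv (Equiv.inv L) _ _ fun κ => by simp
  rw [Finset.sum_sub_distrib, Finset.sum_sub_distrib, h4, Finset.sum_const, Finset.sum_const,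
    Finset.card_univ, ← Nat.cast_smul_eq_nsmul ℝ, ← Nat.cast_smul_eq_nsmul ℝ] at h3
  set Λ := ∑ κ : L, π (j κ)
  set X := average w y π
  have h5 := smul_le_smul_of_nonneg_left h3
    (show 0 ≤ c'⁻¹ / Fintype.card L by positivity)
  rw [average_lazyWeight]
  have h6 : (c'⁻¹ / Fintype.card L) • ((Fintype.card L : ℝ) • (2 : ℝ) • (1 : A) - Λ - Λ) =
      (2 * c'⁻¹) • (1 : A) - (2 * (c'⁻¹ / Fintype.card L)) • Λ := by
    rw [smul_sub, smul_sub, smul_smul, smul_smul, div_mul_cancel₀ _ hcard, mul_comm c'⁻¹ 2, two_mul,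
      two_mul, add_smul _ _ Λ]
    abel
  have h7 : (c'⁻¹ / Fintype.card L) • ((Fintype.card L : ℝ) • c' • (1 - s • X)) = 1 - s • X := by
    rw [smul_smul, smul_smul, div_mul_cancel₀ _ hcard, inv_mul_cancel₀ hc'0.ne', one_smul]
  rw [h6, h7] at h5
  have h8 : (2 * c'⁻¹) = 2 / c' := (div_eq_mul_inv _ _).symm
  have h9 : 2 * (c'⁻¹ / Fintype.card L) = 2 / c' / Fintype.card L := by ring
  rw [h8, h9] at h5
  rw [← sub_nonneg] at h5 ⊢
  convert h5 using 1
  rw [sub_smul, one_smul]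
  abel

/-- Twice the difference is `(b₁ - a₁)(b₂ + a₂) + (b₁ + a₁)(b₂ - a₂)`, a sum of products of
commuting positive elements. -/
theorem mul_le_mul_of_commute {a₁ b₁ a₂ b₂ : A} (h₁ : a₁ ≤ b₁) (h₁' : -a₁ ≤ b₁) (h₂ : a₂ ≤ b₂)
    (h₂' : -a₂ ≤ b₂) (haa : Commute a₁ a₂) (hab : Commute a₁ b₂) (hba : Commute b₁ a₂)
    (hbb : Commute b₁ b₂) : a₁ * a₂ ≤ b₁ * b₂ := by
  have p₁ : 0 ≤ b₁ - a₁ := sub_nonneg.mpr h₁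
  have p₂ : 0 ≤ b₁ + a₁ := by rw [← sub_neg_eq_add]; exact sub_nonneg.mpr h₁'
  have q₁ : 0 ≤ b₂ - a₂ := sub_nonneg.mpr h₂
  have q₂ : 0 ≤ b₂ + a₂ := by rw [← sub_neg_eq_add]; exact sub_nonneg.mpr h₂'
  have r₁ := Commute.mul_nonneg p₁ q₂ ((hbb.add_right hba).sub_left (hab.add_right haa))
  have r₂ := Commute.mul_nonneg p₂ q₁ ((hbb.sub_right hba).add_left (hab.sub_right haa))
  have r₃ := smul_nonneg (by norm_num : (0 : ℝ) ≤ 1 / 2) (add_nonneg r₁ r₂)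
  rw [← sub_nonneg]
  have h : (b₁ - a₁) * (b₂ + a₂) + (b₁ + a₁) * (b₂ - a₂) = (2 : ℝ) • (b₁ * b₂ - a₁ * a₂) := by
    rw [two_smul]
    noncomm_ring
  rwa [h, smul_smul, one_div, inv_mul_cancel₀ two_ne_zero, one_smul] at r₃

/-- The coordinates of `Δ^n` act by commuting operators and the product weights factor, so the
one-coordinate inequality multiplies up by induction. -/
theorem average_pi_le {J : Type*} [Fintype J] {w : I → ℝ} {y : I → Δ} {w' : J → ℝ} {y' : J → Δ}
    (H : ∀ (A : Type v) [CStarAlgebra A] [PartialOrder A] [StarOrderedRing A]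
        (π : Δ →* A) (_ : ∀ g, star (π g) = π g⁻¹) (s : ℝ) (_ : s * s = 1),
        s • average w y π ≤ average w' y' π) (n : ℕ) :
    ∀ (A : Type v) [CStarAlgebra A] [PartialOrder A] [StarOrderedRing A]
        (π : (Fin n → Δ) →* A) (_ : ∀ g, star (π g) = π g⁻¹) (s : ℝ) (_ : s * s = 1),
        s • average (fun i : Fin n → I => ∏ k, w (i k)) (fun i k => y (i k)) π ≤
          average (fun i : Fin n → J => ∏ k, w' (i k)) (fun i k => y' (i k)) π := by
  induction n with
  | zero =>
    intro A _ _ _ π hπ s hs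
    have h1 : ∀ γ : Fin 0 → Δ, π γ = 1 := fun γ => by rw [Subsingleton.elim γ 1, map_one]
    simp only [average, h1, Finset.univ_unique, Finset.sum_singleton, Finset.prod_empty,
      Finset.univ_eq_empty, one_smul]
    rcases mul_self_eq_one_iff.mp hs with rfl | rfl
    · simp
    · rw [neg_one_smul, ← sub_nonneg, sub_neg_eq_add]
      exact add_nonneg zero_le_one zero_le_one
  | succ n ih =>
    intro A _ _ _ π hπ s hs
    rw [average_cons, average_cons]
    set π₀ := π.comp (MonoidHom.mulSingle (fun _ : Fin (n + 1) => Δ) 0)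
    set π₁ := π.comp (consOneHom Δ n)
    have star₀ : ∀ g, star (π₀ g) = π₀ g⁻¹ := fun g => by
      rw [MonoidHom.comp_apply, MonoidHom.comp_apply, MonoidHom.map_inv, hπ]
    have star₁ : ∀ g, star (π₁ g) = π₁ g⁻¹ := fun g => by
      rw [MonoidHom.comp_apply, MonoidHom.comp_apply, MonoidHom.map_inv, hπ]
    have hcomm : ∀ a b, Commute (π₀ a) (π₁ b) := by
      intro a b
      rw [MonoidHom.comp_apply, MonoidHom.comp_apply]
      refine Commute.map (funext fun k => ?_) π
      refine Fin.cases ?_ (fun k => ?_) k <;> simp [consOneHom]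
    have hs' : -s * -s = 1 := by rw [neg_mul_neg, hs]
    rw [← smul_mul_assoc]
    refine mul_le_mul_of_commute (H A π₀ star₀ s hs) ?_ ?_ ?_ ?_ ?_ ?_ ?_
    · rw [← neg_smul]
      exact H A π₀ star₀ (-s) hs'
    · simpa using ih A π₁ star₁ 1 (one_mul 1)
    · simpa using ih A π₁ star₁ (-1) (by norm_num)
    · exact (average_commute hcomm _ _ _ _).smul_left s
    · exact (average_commute hcomm _ _ _ _).smul_left s
    · exact average_commute hcomm _ _ _ _
    · exact average_commute hcomm _ _ _ _

end Gap

/-! ### Correlations of vectors under permutation actions -/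

section Correlation

universe u

variable {Γ : Type*} [Group Γ] {Y : Type*} [Fintype Y]

/-- The correlation `⟨v, γ v⟩` of a vector with its translate under a permutation action. -/
def corr (α : Γ →* Equiv.Perm Y) (v : Y → ℂ) (γ : Γ) : ℂ := ∑ x, star (v (α γ x)) * v x

theorem corr_one (α : Γ →* Equiv.Perm Y) (v : Y → ℂ) :
    corr α v 1 = ((∑ x, ‖v x‖ ^ 2 : ℝ) : ℂ) := by
  simp only [corr, map_one, Equiv.Perm.one_apply, Complex.ofReal_sum]
  refine Finset.sum_congr rfl fun x _ => ?_
  rw [Complex.ofReal_pow, ← Complex.conj_mul' (v x), Complex.star_def]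

theorem corr_inv (α : Γ →* Equiv.Perm Y) (v : Y → ℂ) (γ : Γ) :
    corr α v γ⁻¹ = star (corr α v γ) := by
  simp only [corr, star_sum, star_mul', star_star]
  refine Fintype.sum_equiv (α γ⁻¹) _ _ fun x => ?_
  rw [← Equiv.Perm.mul_apply, ← map_mul, mul_inv_cancel, map_one, Equiv.Perm.one_apply, mul_comm]

open Classical in
/-- The unitary representation by permutation matrices. -/
def permRep (α : Γ →* Equiv.Perm Y) : Γ →* Matrix Y Y ℂ where
  toFun γ := Matrix.of fun x y => if x = α γ y then 1 else 0
  map_one' := by ext x y; simp [Matrix.one_apply]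
  map_mul' a b := by ext x y; simp [Matrix.mul_apply]

theorem star_permRep (α : Γ →* Equiv.Perm Y) (γ : Γ) :
    star (permRep α γ) = permRep α γ⁻¹ := by
  ext x y
  have : (y = α γ x) ↔ (x = (α γ)⁻¹ y) := by rw [Equiv.Perm.eq_inv_iff_eq, eq_comm]
  rw [← map_inv] at this
  simp only [permRep, MonoidHom.coe_mk, OneHom.coe_mk, Matrix.star_apply, Matrix.of_apply,
    apply_ite star, star_one, star_zero]
  by_cases h : y = α γ x
  · rw [if_pos h, if_pos (this.mp h)]
  · rw [if_neg h, if_neg (mt this.mpr h)]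

theorem dotProduct_permRep (α : Γ →* Equiv.Perm Y) (v : Y → ℂ) (γ : Γ) :
    star v ⬝ᵥ (permRep α γ).mulVec v = corr α v γ := by
  simp only [permRep, dotProduct, Matrix.mulVec, MonoidHom.coe_mk, OneHom.coe_mk, Matrix.of_apply,
    Finset.mul_sum, corr]
  rw [Finset.sum_comm]
  refine Finset.sum_congr rfl fun x _ => ?_
  rw [Finset.sum_eq_single (α γ x) (fun y _ hy => by simp [hy]) (by simp)]
  simp

theorem re_dotProduct_average {I : Type*} [Fintype I] (w : I → ℝ) (y : I → Γ)
    (α : Γ →* Equiv.Perm Y) (v : Y → ℂ) :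
    (star v ⬝ᵥ (∑ i, w i • permRep α (y i)).mulVec v).re = ∑ i, w i * (corr α v (y i)).re := by
  simp only [Matrix.sum_mulVec, dotProduct_sum, Matrix.smul_mulVec, dotProduct_smul,
    dotProduct_permRep, Complex.re_sum, Complex.real_smul, Complex.re_ofReal_mul]

open scoped MatrixOrder Matrix.Norms.L2Operator in
/-- Inequalities between averages of unitary representations yield inequalities between averages of
correlations, for the product actions as well. -/
theorem sum_corr_le {Δ : Type*} [Group Δ] {I J : Type*} [Fintype I] [Fintype J] {w : I → ℝ}
    {y : I → Δ} {w' : J → ℝ} {y' : J → Δ}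
    (H : ∀ (A : Type u) [CStarAlgebra A] [PartialOrder A] [StarOrderedRing A]
        (π : Δ →* A) (_ : ∀ g, star (π g) = π g⁻¹) (s : ℝ) (_ : s * s = 1),
        s • average w y π ≤ average w' y' π) {n : ℕ} {Y : Type u} [Fintype Y]
    (α : (Fin n → Δ) →* Equiv.Perm Y) (v : Y → ℂ) :
    ∑ i : Fin n → I, (∏ k, w (i k)) * (corr α v fun k => y (i k)).re ≤
      ∑ i : Fin n → J, (∏ k, w' (i k)) * (corr α v fun k => y' (i k)).re := by
  classical
  -- The inequality is evaluated in the C⋆-algebra of matrices, at the permutation representation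
  -- and the vector `v`.
  have h1 := average_pi_le H n (Matrix Y Y ℂ) (permRep α) (star_permRep α) 1 (one_mul 1)
  rw [one_smul, Matrix.le_iff] at h1
  have h2 := (Complex.le_def.mp (h1.dotProduct_mulVec_nonneg v)).1
  rw [Matrix.sub_mulVec, dotProduct_sub, Complex.sub_re, Complex.zero_re, sub_nonneg] at h2
  rw [average, average, re_dotProduct_average, re_dotProduct_average] at h2
  exact h2

end Correlation

/-! ### The two comparison inequalities and the second moment of a correlation -/

section Gap

universe u

variable {G : Type u} [Group G]

theorem exists_first_gap [Fintype G] {h : G} [Fintype (conjProducts h)]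
    (h_inv : orderOf h = 2) :
    ∃ δ : ℝ, 0 < δ ∧ δ ≤ 1 ∧ ∀ (A : Type u) [CStarAlgebra A] [PartialOrder A] [StarOrderedRing A]
        (π : G →* A) (_ : ∀ g, star (π g) = π g⁻¹) (s : ℝ) (_ : s * s = 1),
        s • average (fun _ : G => (Fintype.card G : ℝ)⁻¹) (fun g => g * h * g⁻¹) π ≤
          average (lazyWeight (conjProducts h) δ) (conjProducts h).subtype π := by
  have hh : h⁻¹ = h := inv_eq_of_mul_eq_one_left (by rw [← sq, ← h_inv, pow_orderOf_eq_one])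
  have hcard : (0 : ℝ) < Fintype.card G := by exact_mod_cast Fintype.card_pos
  have hw : IsSymmetricWeight (fun _ : G => (Fintype.card G : ℝ)⁻¹) (fun g => g * h * g⁻¹) :=
    { pos := fun _ => by positivity
      sum_eq_one := by simp [hcard.ne']
      symm := ⟨Equiv.refl _, fun g => ⟨by simp [mul_assoc, hh], rfl⟩⟩ }
  refine hw.exists_gap _ fun κ => ?_
  exact κ.2

/-- The elements `(κ, κ⁻¹)` generate a subgroup of `K × K` that contains `[K, K] × 1`. This is where
noncommutativity enters. -/
theorem exists_second_gap (K : Type*) [Group K] [Fintype K] [Fintype (commutator K)] 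
    {δ : ℝ} (h0 : 0 < δ) (h1 : δ ≤ 1) :
    ∃ η : ℝ, 0 < η ∧ η ≤ 1 ∧ ∀ (A : Type u) [CStarAlgebra A] [PartialOrder A] [StarOrderedRing A]
        (π : K × K →* A) (_ : ∀ g, star (π g) = π g⁻¹) (s : ℝ) (_ : s * s = 1),
        s • average (lazyWeight K δ) (fun κ => (κ, κ⁻¹)) π ≤
          average (lazyWeight (commutator K) η)
            ((MonoidHom.inl K K).comp (commutator K).subtype) π := by
  have hw : IsSymmetricWeight (lazyWeight K δ) (fun κ : K => (κ, κ⁻¹)) :=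
    { pos := lazyWeight_pos K h0 h1
      sum_eq_one := sum_lazyWeight K δ
      symm := ⟨Equiv.inv K, fun κ => ⟨rfl, lazyWeight_inv K δ κ⟩⟩ }
  refine hw.exists_gap _ fun κ => ?_
  have key : ∀ a : K, (a, a⁻¹) ∈
      Subgroup.closure {z : K × K | ∃ i j : K, z = (i, i⁻¹) * (j, j⁻¹)} := fun a =>
    Subgroup.subset_closure ⟨a, 1, by simp⟩
  have h2 : commutator K ≤ (Subgroup.closure
      {z : K × K | ∃ i j : K, z = (i, i⁻¹) * (j, j⁻¹)}).comap (MonoidHom.inl K K) := by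
    rw [commutator_def, Subgroup.commutator_le]
    intro a _ b _
    rw [Subgroup.mem_comap]
    -- The second coordinate is `a⁻¹b⁻¹(ba) = 1`, the first is `ab(ba)⁻¹ = [a, b]`.
    have h3 := mul_mem (mul_mem (key a) (key b)) (inv_mem (key (b * a)))
    convert h3 using 1
    simp [commutatorElement_def, mul_assoc]
  exact h2 κ.2

/-- The diagonal action of a product group on pairs. -/
def pairAction {Δ Γ X : Type*} [Group Δ] [Group Γ] (α : Γ →* Equiv.Perm X) (f g : Δ →* Γ) :
    Δ →* Equiv.Perm (X × X) where
  toFun γ := Equiv.prodCongr (α (f γ)) (α (g γ))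
  map_one' := by ext x <;> simp
  map_mul' a b := by ext x <;> simp

theorem corr_pairAction {Δ Γ X : Type*} [Group Δ] [Group Γ] [Fintype X] (α : Γ →* Equiv.Perm X)
    (f g : Δ →* Γ) (b c : X → ℂ) (γ : Δ) :
    corr (pairAction α f g) (fun p => b p.1 * c p.2) γ = corr α b (f γ) * corr α c (g γ) := by
  simp only [corr, pairAction, MonoidHom.coe_mk, OneHom.coe_mk, Equiv.prodCongr_apply,
    Prod.map_fst, Prod.map_snd, star_mul', Finset.sum_mul_sum]
  rw [Fintype.sum_prod_type]
  exact Finset.sum_congr rfl fun x _ => Finset.sum_congr rfl fun y _ => by ring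

theorem corr_star {Γ X : Type*} [Group Γ] [Fintype X] (α : Γ →* Equiv.Perm X) (b : X → ℂ)
    (γ : Γ) : corr α (fun x => star (b x)) γ = star (corr α b γ) := by
  simp [corr, star_sum]

/-- Both inequalities are applied to tensor squares; the aim is a right-hand side linear in the
correlations of `b`, which can be summed over a frame. -/
theorem sum_sq_corr_le [Fintype G] {h : G} {K : Subgroup G} [Fintype K] [Fintype (commutator K)]
    {δ η : ℝ}
    (h₁ : ∀ (A : Type u) [CStarAlgebra A] [PartialOrder A] [StarOrderedRing A]
      (π : G →* A) (_ : ∀ g, star (π g) = π g⁻¹) (s : ℝ) (_ : s * s = 1),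
      s • average (fun _ : G => (Fintype.card G : ℝ)⁻¹) (fun g => g * h * g⁻¹) π ≤
        average (lazyWeight K δ) K.subtype π)
    (h₂ : ∀ (A : Type u) [CStarAlgebra A] [PartialOrder A] [StarOrderedRing A]
      (π : K × K →* A) (_ : ∀ g, star (π g) = π g⁻¹) (s : ℝ) (_ : s * s = 1),
      s • average (lazyWeight K δ) (fun κ => (κ, κ⁻¹)) π ≤
        average (lazyWeight (commutator K) η)
          ((MonoidHom.inl K K).comp (commutator K).subtype) π)
    {n : ℕ} {X : Type u} [Fintype X] (α : (Fin n → G) →* Equiv.Perm X) (b : X → ℂ) :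
    ∑ g : Fin n → G, ‖corr α b (g * (fun _ => h) * g⁻¹)‖ ^ 2 ≤
      (Fintype.card G : ℝ) ^ n * ((∑ x, ‖b x‖ ^ 2) * ∑ κ : Fin n → commutator K,
        (∏ k, lazyWeight (commutator K) η (κ k)) * (corr α b fun k => ((κ k : K) : G)).re) := by
  have hcard : (0 : ℝ) < (Fintype.card G : ℝ) ^ n :=
    pow_pos (by exact_mod_cast Fintype.card_pos) n
  -- For `b ⊗ b̄` the diagonal correlation at `γ` is `|⟨b, γ b⟩|²`.
  have s₁ := sum_corr_le h₁ (n := n) (pairAction α (MonoidHom.id _) (MonoidHom.id _))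
    (fun p => b p.1 * star (b p.2))
  let ι : (Fin n → K) →* (Fin n → G) := K.subtype.compLeft (Fin n)
  let f₁ : (Fin n → K × K) →* (Fin n → K) := (MonoidHom.fst K K).compLeft (Fin n)
  let f₂ : (Fin n → K × K) →* (Fin n → K) := (MonoidHom.snd K K).compLeft (Fin n)
  -- For `b ⊗ b` the correlation at `(κ, κ⁻¹)` is again `|⟨b, κ b⟩|²`, while at `(c, 1)` it is `⟨b,
  -- c b⟩ ‖b‖²`.
  have s₂ := sum_corr_le h₂ (n := n) (pairAction α (ι.comp f₁) (ι.comp f₂))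
    (fun p => b p.1 * b p.2)
  have hnorm : ∀ z : ℂ, (z * star z).re = ‖z‖ ^ 2 := fun z => by
    rw [Complex.star_def, Complex.mul_conj', ← Complex.ofReal_pow, Complex.ofReal_re]
  rw [← inv_mul_le_iff₀ hcard]
  calc ((Fintype.card G : ℝ) ^ n)⁻¹ * ∑ g : Fin n → G, ‖corr α b (g * (fun _ => h) * g⁻¹)‖ ^ 2
      = ∑ g : Fin n → G, (∏ _k : Fin n, (Fintype.card G : ℝ)⁻¹) *
          (corr (pairAction α (MonoidHom.id _) (MonoidHom.id _))
            (fun p => b p.1 * star (b p.2)) fun k => g k * h * (g k)⁻¹).re := by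
        rw [Finset.mul_sum]
        refine Finset.sum_congr rfl fun g _ => ?_
        rw [corr_pairAction α _ _ b (fun x => star (b x)), corr_star, hnorm, Finset.prod_const,
          Finset.card_univ, Fintype.card_fin, inv_pow]
        rfl
    _ ≤ _ := s₁
    _ = ∑ κ : Fin n → K, (∏ k, lazyWeight K δ (κ k)) *
          (corr (pairAction α (ι.comp f₁) (ι.comp f₂)) (fun p => b p.1 * b p.2)
            fun k => (κ k, (κ k)⁻¹)).re := by
        refine Finset.sum_congr rfl fun κ _ => ?_
        rw [corr_pairAction α _ _ b (fun x => star (b x)), corr_star,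
          corr_pairAction α _ _ b b, ← corr_inv]
        rfl
    _ ≤ _ := s₂
    _ = _ := by
        rw [Finset.mul_sum]
        refine Finset.sum_congr rfl fun κ _ => ?_
        rw [corr_pairAction α _ _ b b]
        have e₁ : (ι.comp f₁) (fun k =>
            ((MonoidHom.inl K K).comp (commutator K).subtype) (κ k)) = fun k => ((κ k : K) : G) :=
          rfl
        have e₂ : (ι.comp f₂) (fun k =>
            ((MonoidHom.inl K K).comp (commutator K).subtype) (κ k)) = 1 := rfl
        rw [e₁, e₂, corr_one, Complex.re_mul_ofReal]
        ring

end Gap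

/-! ### Frames of free permutation representations -/

section FreeAction

variable {Γ X Z : Type*} [Group Γ] [Fintype X] [DecidableEq X] [Fintype Z]

/-- A family of vectors resolving the identity: `∑_z |b_z⟩⟨b_z| = 1`. -/
def IsFrame (B : Z → X → ℂ) : Prop :=
  ∀ x y, ∑ z, star (B z x) * B z y = if x = y then 1 else 0

theorem IsFrame.sum_norm_sq {B : Z → X → ℂ} (hB : IsFrame B) :
    ∑ z, ∑ x, ‖B z x‖ ^ 2 = Fintype.card X := by
  rw [Finset.sum_comm]
  have h1 : ∀ x, ∑ z, ‖B z x‖ ^ 2 = 1 := fun x => by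
    have h2 := hB x x
    rw [if_pos rfl] at h2
    simp only [Complex.star_def, Complex.conj_mul'] at h2
    exact_mod_cast h2
  simp [h1]

/-- The sum is the trace of a permutation matrix without fixed points. -/
theorem IsFrame.sum_corr {B : Z → X → ℂ} (hB : IsFrame B) (α : Γ →* Equiv.Perm X)
    (hα : ∀ γ x, α γ x = x → γ = 1) {γ : Γ} (hγ : γ ≠ 1) : ∑ z, corr α (B z) γ = 0 := by
  simp only [corr]
  rw [Finset.sum_comm]
  refine Finset.sum_eq_zero fun x _ => ?_
  rw [hB, if_neg fun h => hγ (hα γ x h)]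

end FreeAction

section Moment

universe u

variable {G : Type u} [Group G]

open scoped commutatorElement in
/-- For a frame of a free permutation representation, the correlations with random conjugates of
`(h, …, h)` are exponentially small on average. -/
theorem exists_sum_corr_le [Fintype G] {h : G} (h_inv : orderOf h = 2)
    (hK : ∃ a ∈ conjProducts h, ∃ b ∈ conjProducts h, a * b ≠ b * a) :
    ∃ q : ℝ, 0 < q ∧ q < 1 ∧ ∀ (n : ℕ) (X : Type u) [Fintype X] [DecidableEq X]
      (α : (Fin n → G) →* Equiv.Perm X) (_ : ∀ γ x, α γ x = x → γ = 1)
      (Z : Type u) [Fintype Z] (B : Z → X → ℂ) (_ : IsFrame B),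
      ∑ z, ∑ g : Fin n → G, ‖corr α (B z) (g * (fun _ => h) * g⁻¹)‖ ≤
        (Fintype.card G : ℝ) ^ n * Fintype.card X * q ^ n := by
  classical
  let K := conjProducts h
  obtain ⟨δ, hδ0, hδ1, h₁⟩ := exists_first_gap h_inv
  obtain ⟨η, hη0, hη1, h₂⟩ := exists_second_gap (conjProducts h) hδ0 hδ1
  set p : ℝ := lazyWeight (commutator K) η 1 with hp
  have hp0 : 0 < p := lazyWeight_pos _ hη0 hη1 1
  have hcomm : (1 : ℝ) < Fintype.card (commutator K) := by
    have : Nontrivial (commutator K) := by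
      rw [Subgroup.nontrivial_iff_ne_bot]
      intro hbot
      obtain ⟨a, ha, b, hb, hab⟩ := hK
      have h1 : ⁅(⟨a, ha⟩ : K), (⟨b, hb⟩ : K)⁆ ∈ commutator K := by
        rw [commutator_def]
        exact Subgroup.commutator_mem_commutator (Subgroup.mem_top _) (Subgroup.mem_top _)
      rw [hbot, Subgroup.mem_bot, commutatorElement_eq_one_iff_mul_comm] at h1
      exact hab (congrArg Subtype.val h1)
    exact_mod_cast Fintype.one_lt_card
  -- The mass at the identity is `1 - η + η / |[K, K]|`, and `[K, K]` is nontrivial.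
  have hp1 : p < 1 := by
    have h1 : η / Fintype.card (commutator K) < η := div_lt_self hη0 hcomm
    simp only [hp, lazyWeight, if_true]
    linarith
  refine ⟨√p, Real.sqrt_pos.mpr hp0, by rwa [Real.sqrt_lt' one_pos, one_pow], ?_⟩
  intro n X _ _ α hα Z _ B hB
  set N : ℝ := (Fintype.card G : ℝ) ^ n with hN
  have hN0 : 0 < N := pow_pos (by exact_mod_cast Fintype.card_pos) n
  set a : Z → ℝ := fun z => ∑ x, ‖B z x‖ ^ 2 with ha
  set P : Z → ℝ := fun z => ∑ κ : Fin n → commutator K,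
        (∏ k, lazyWeight (commutator K) η (κ k)) * (corr α (B z) fun k => ((κ k : K) : G)).re with hP
  set r : Z → ℝ := fun z => ∑ g : Fin n → G, ‖corr α (B z) (g * (fun _ => h) * g⁻¹)‖ with hr
  have ha0 : ∀ z, 0 ≤ a z := fun z => Finset.sum_nonneg fun x _ => sq_nonneg _
  have hmom := fun z => sum_sq_corr_le h₁ h₂ α (B z)
  -- Positivity of `P z` is read off from the moment inequality when `B z ≠ 0`.
  have hP0 : ∀ z, 0 ≤ P z := by
    intro z
    rcases (ha0 z).eq_or_lt with h0 | hpos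
    · have h1 : ∀ x, B z x = 0 := fun x => by
        have := (Finset.sum_eq_zero_iff_of_nonneg fun x _ => sq_nonneg _).mp h0.symm x
          (Finset.mem_univ x)
        simpa using this
      simp [hP, corr, h1]
    · have h1 : 0 ≤ N * (a z * P z) := (Finset.sum_nonneg fun g _ => sq_nonneg _).trans (hmom z)
      exact nonneg_of_mul_nonneg_right (nonneg_of_mul_nonneg_right h1 hN0) hpos
  have hr2 : ∀ z, r z ^ 2 ≤ N ^ 2 * (a z * P z) := by
    intro z
    have h1 := sq_sum_le_card_mul_sum_sq (s := (Finset.univ : Finset (Fin n → G)))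
      (f := fun g => ‖corr α (B z) (g * (fun _ => h) * g⁻¹)‖)
    rw [Finset.card_univ, Fintype.card_fun, Fintype.card_fin, Nat.cast_pow] at h1
    calc r z ^ 2 ≤ N * _ := h1
      _ ≤ N * (N * (a z * P z)) := mul_le_mul_of_nonneg_left (hmom z) hN0.le
      _ = _ := by ring
  -- Only `κ = 1` survives the sum over the frame.
  have hsumP : ∑ z, P z = Fintype.card X * p ^ n := by
    simp only [hP]
    rw [Finset.sum_comm, Finset.sum_eq_single 1]
    · rw [← Finset.mul_sum, mul_comm]
      congr 1
      · have h1 : (fun k => (((1 : Fin n → commutator K) k : K) : G)) = 1 := rfl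
        simp only [h1, corr_one, Complex.ofReal_re]
        exact hB.sum_norm_sq
      · simp [hp]
    · intro κ _ hκ
      rw [← Finset.mul_sum, ← Complex.re_sum, hB.sum_corr α hα, Complex.zero_re, mul_zero]
      intro h1
      refine hκ (funext fun k => Subtype.ext (Subtype.ext ?_))
      exact congrFun h1 k
    · simp
  have hle : ∀ z, r z ≤ N * (√(a z) * √(P z)) := by
    intro z
    rw [← Real.sqrt_mul (ha0 z)]
    refine le_of_sq_le_sq ?_ (by positivity)
    rw [mul_pow, Real.sq_sqrt (mul_nonneg (ha0 z) (hP0 z))]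
    exact hr2 z
  calc ∑ z, r z ≤ ∑ z, N * (√(a z) * √(P z)) := Finset.sum_le_sum fun z _ => hle z
    _ = N * ∑ z, √(a z) * √(P z) := by rw [Finset.mul_sum]
    _ ≤ N * (√(∑ z, a z) * √(∑ z, P z)) :=
        mul_le_mul_of_nonneg_left (Real.sum_sqrt_mul_sqrt_le _ ha0 hP0) hN0.le
    _ = N * Fintype.card X * √p ^ n := by
        have h1 : √(p ^ n) = √p ^ n := by
          rw [Real.sqrt_eq_iff_eq_sq (by positivity) (by positivity), ← pow_mul, mul_comm n 2,
            pow_mul, Real.sq_sqrt hp0.le]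
        rw [hsumP, hB.sum_norm_sq, Real.sqrt_mul (Nat.cast_nonneg _), h1, ← mul_assoc (√_),
          Real.mul_self_sqrt (Nat.cast_nonneg _), mul_assoc]

end Moment

/-! ### Powers of coset states -/

section Registers

variable {Γ : Type*} [Group Γ]

/-- The action of `Γ` on `m` registers by right multiplication on the registers in `S`. -/
def registerAction {m : ℕ} (S : Finset (Fin m)) : Γ →* Equiv.Perm (Fin m → Γ) where
  toFun γ := Equiv.piCongrRight fun i => if i ∈ S then Equiv.mulRight γ⁻¹ else Equiv.refl Γ
  map_one' := by
    ext x i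
    by_cases h : i ∈ S <;> simp [h]
  map_mul' a b := by
    ext x i
    by_cases h : i ∈ S <;> simp [h, mul_assoc]

theorem registerAction_apply {m : ℕ} (S : Finset (Fin m)) (γ : Γ) (x : Fin m → Γ) (i : Fin m) :
    registerAction S γ x i = if i ∈ S then x i * γ⁻¹ else x i := by
  by_cases h : i ∈ S <;> simp [registerAction, h]

theorem registerAction_free {m : ℕ} {S : Finset (Fin m)} (hS : S.Nonempty) (γ : Γ)
    (x : Fin m → Γ) (h : registerAction S γ x = x) : γ = 1 := by
  obtain ⟨i, hi⟩ := hS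
  have h1 := congrFun h i
  rw [registerAction_apply, if_pos hi] at h1
  simpa using h1

variable [Fintype Γ]

open Classical in
theorem cosetState_apply (H : Subgroup Γ) (x y : Γ) :
    cosetState H x y = if x⁻¹ * y ∈ H then (Fintype.card Γ : ℂ)⁻¹ else 0 := by
  have hH : (Nat.card H : ℝ) ≠ 0 := by exact_mod_cast Nat.card_pos.ne'
  have hsq : ((1 / √(Nat.card H) : ℝ) : ℂ) * star ((1 / √(Nat.card H) : ℝ) : ℂ) =
      (Nat.card H : ℂ)⁻¹ := by
    rw [Complex.star_def, Complex.conj_ofReal, ← Complex.ofReal_mul, div_mul_div_comm, one_mul,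
      Real.mul_self_sqrt (Nat.cast_nonneg _), one_div]
    push_cast
    rfl
  have hterm : ∀ g, cosetVec H g x * star (cosetVec H g y) =
      if x⁻¹ * y ∈ H then (if g⁻¹ * x ∈ H then (Nat.card H : ℂ)⁻¹ else 0) else 0 := by
    intro g
    unfold cosetVec
    by_cases h1 : g⁻¹ * x ∈ H
    · have h2 : g⁻¹ * y ∈ H ↔ x⁻¹ * y ∈ H := by
        have : g⁻¹ * y = g⁻¹ * x * (x⁻¹ * y) := by group
        rw [this, H.mul_mem_cancel_left h1]
      by_cases h3 : x⁻¹ * y ∈ H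
      · rw [if_pos h1, if_pos (h2.mpr h3), if_pos h3, if_pos h1, hsq]
      · rw [if_neg (mt h2.mp h3), if_neg h3, star_zero, mul_zero]
    · simp [h1]
  have hcount : ∑ g : Γ, (if g⁻¹ * x ∈ H then (Nat.card H : ℂ)⁻¹ else 0) = 1 := by
    rw [Fintype.sum_equiv (((Equiv.inv Γ).trans (Equiv.mulRight x)) : Equiv.Perm Γ)
      (fun g => if g⁻¹ * x ∈ H then (Nat.card H : ℂ)⁻¹ else 0)
      (fun g => if g ∈ H then (Nat.card H : ℂ)⁻¹ else 0) (fun g => by simp),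
      ← Finset.sum_filter, Finset.sum_const, nsmul_eq_mul]
    have h1 : (Finset.univ.filter (· ∈ H)).card = Nat.card H := by
      rw [Nat.card_eq_fintype_card, Fintype.card_subtype]
    rw [h1, mul_inv_cancel₀]
    exact_mod_cast hH
  simp only [cosetState, Matrix.smul_apply, Matrix.sum_apply, Matrix.vecMulVec_apply, Pi.star_apply,
    hterm, smul_eq_mul]
  by_cases h : x⁻¹ * y ∈ H
  · simp only [h, if_true, hcount, mul_one]
  · simp [h]

theorem cosetStatePow_posSemidef (H : Subgroup Γ) (m : ℕ) : (cosetStatePow H m).PosSemidef := by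
  classical
  let W : Matrix (Fin m → Γ) (Fin m → Γ) ℂ :=
    Matrix.of fun x g => ∏ i, cosetVec H (g i) (x i)
  have h1 : cosetStatePow H m = ((Fintype.card Γ : ℂ)⁻¹ ^ m) • (W * W.conjTranspose) := by
    ext x y
    have h2 : ∀ i, cosetState H (x i) (y i) = (Fintype.card Γ : ℂ)⁻¹ *
        ∑ g, cosetVec H g (x i) * star (cosetVec H g (y i)) := fun i => by
      simp only [cosetState, Matrix.smul_apply, Matrix.sum_apply, Matrix.vecMulVec_apply,
        Pi.star_apply, smul_eq_mul]
    simp only [cosetStatePow, Matrix.of_apply, h2]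
    rw [Finset.prod_mul_distrib, Finset.prod_const, Finset.card_univ, Fintype.card_fin,
      Finset.prod_univ_sum, Fintype.piFinset_univ, Matrix.smul_apply, Matrix.mul_apply, smul_eq_mul]
    simp only [W, Matrix.conjTranspose_apply, Matrix.of_apply, star_prod, Finset.prod_mul_distrib]
  rw [h1]
  refine (Matrix.posSemidef_self_mul_conjTranspose W).smul ?_
  refine pow_nonneg ?_ m
  rw [inv_nonneg]
  exact Nat.cast_nonneg _

theorem trace_cosetStatePow (H : Subgroup Γ) (m : ℕ) : (cosetStatePow H m).trace = 1 := by
  have h : (Fintype.card Γ : ℂ) ≠ 0 := by exact_mod_cast Fintype.card_ne_zero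
  simp [Matrix.trace, cosetStatePow, cosetState_apply, one_mem, h]

open scoped MatrixOrder Matrix.Norms.L2Operator in
theorem exists_eq_conjTranspose_mul_self {I : Type*} [Fintype I] [DecidableEq I]
    {E : Matrix I I ℂ} (hE : E.PosSemidef) : ∃ C : Matrix I I ℂ, E = C.conjTranspose * C :=
  CStarAlgebra.nonneg_iff_eq_star_mul_self.mp hE.nonneg

theorem POVM.prob_nonneg {I : Type*} [Fintype I] [DecidableEq I] {r : ℕ} (M : POVM I r)
    {s : Matrix I I ℂ} (hs : s.PosSemidef) (i : Fin r) : 0 ≤ M.prob s i := by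
  obtain ⟨C, hC⟩ := exists_eq_conjTranspose_mul_self (M.posSemidef i)
  have h1 : (M.elem i * s).trace = (C * s * C.conjTranspose).trace := by
    rw [hC, Matrix.mul_assoc, Matrix.trace_mul_comm]
  rw [POVM.prob, h1]
  exact (Complex.le_def.mp (hs.mul_mul_conjTranspose_same C).trace_nonneg).1

theorem POVM.sum_prob {I : Type*} [Fintype I] [DecidableEq I] {r : ℕ} (M : POVM I r)
    {s : Matrix I I ℂ} (hs : s.trace = 1) : ∑ i, M.prob s i = 1 := by
  simp only [POVM.prob]
  rw [← Complex.re_sum, ← Matrix.trace_sum, ← Finset.sum_mul, M.sum_eq_one, one_mul, hs,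
    Complex.one_re]

variable [DecidableEq Γ]

theorem CosetAlgorithm.acceptProb_mem (H : Subgroup Γ) (A : CosetAlgorithm Γ) :
    0 ≤ A.acceptProb H ∧ A.acceptProb H ≤ 1 := by
  induction A with
  | halt b => cases b <;> simp [acceptProb]
  | measure m r M next ih =>
    have h0 := M.prob_nonneg (cosetStatePow_posSemidef H m)
    constructor
    · exact Finset.sum_nonneg fun i _ => mul_nonneg (h0 i) (ih i).1
    · rw [← M.sum_prob (trace_cosetStatePow H m)]
      exact Finset.sum_le_sum fun i _ => mul_le_of_le_one_right (h0 i) (ih i).2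

/-- The power of the coset state of a subgroup of order two, in terms of right multiplications. -/
theorem cosetStatePow_apply {H : Subgroup Γ} {t : Γ} (ht : t ≠ 1) (htt : t⁻¹ = t)
    (hH : ∀ u, u ∈ H ↔ u = 1 ∨ u = t) (m : ℕ) (x y : Fin m → Γ) :
    cosetStatePow H m x y = (Fintype.card Γ : ℂ)⁻¹ ^ m *
      ∑ S : Finset (Fin m), if y = registerAction S t x then 1 else 0 := by
  classical
  have h1 : ∀ i, cosetState H (x i) (y i) = (Fintype.card Γ : ℂ)⁻¹ *
      ((if y i = x i * t⁻¹ then 1 else 0) + (if y i = x i then 1 else 0)) := by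
    intro i
    have e1 : (x i)⁻¹ * y i = 1 ↔ y i = x i := by rw [inv_mul_eq_one, eq_comm]
    have e2 : (x i)⁻¹ * y i = t ↔ y i = x i * t := inv_mul_eq_iff_eq_mul
    rw [cosetState_apply, htt]
    by_cases c1 : y i = x i
    · have c2 : y i ≠ x i * t := by rw [c1]; simpa using ht
      rw [if_pos ((hH _).mpr (Or.inl (e1.mpr c1))), if_neg c2, if_pos c1]
      ring
    · by_cases c2 : y i = x i * t
      · rw [if_pos ((hH _).mpr (Or.inr (e2.mpr c2))), if_neg c1, if_pos c2]
        ring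
      · rw [if_neg, if_neg c1, if_neg c2]
        · ring
        · rw [hH, e1, e2]
          tauto
  simp only [cosetStatePow, Matrix.of_apply, h1, Finset.prod_mul_distrib, Finset.prod_const,
    Finset.card_univ, Fintype.card_fin]
  -- In the expansion, `S` is the set of registers where the factor of `t` is chosen.
  rw [Finset.prod_add]
  congr 1
  rw [Finset.powerset_univ]
  refine Finset.sum_congr rfl fun S _ => ?_
  have h2 : (y = registerAction S t x) ↔ (∀ i ∈ S, y i = x i * t⁻¹) ∧
      ∀ i ∈ Finset.univ \ S, y i = x i := by
    rw [funext_iff]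
    constructor
    · intro h
      refine ⟨fun i hi => ?_, fun i hi => ?_⟩
      · rw [h, registerAction_apply, if_pos hi]
      · rw [h, registerAction_apply, if_neg (Finset.mem_sdiff.mp hi).2]
    · rintro ⟨h, h'⟩ i
      by_cases hi : i ∈ S
      · rw [registerAction_apply, if_pos hi, h i hi]
      · rw [registerAction_apply, if_neg hi, h' i (by simp [hi])]
  rw [Finset.prod_ite_zero, Finset.prod_ite_zero]
  simp only [Finset.prod_const_one, h2, ite_and]
  split_ifs <;> simp

theorem cosetStatePow_bot (m : ℕ) (x y : Fin m → Γ) :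
    cosetStatePow (⊥ : Subgroup Γ) m x y =
      (Fintype.card Γ : ℂ)⁻¹ ^ m * if y = x then 1 else 0 := by
  classical
  have h1 : ∀ i, cosetState (⊥ : Subgroup Γ) (x i) (y i) = (Fintype.card Γ : ℂ)⁻¹ *
      (if y i = x i then 1 else 0) := by
    intro i
    have e1 : (x i)⁻¹ * y i = 1 ↔ y i = x i := by rw [inv_mul_eq_one, eq_comm]
    simp [cosetState_apply, Subgroup.mem_bot, e1]
  simp only [cosetStatePow, Matrix.of_apply, h1, Finset.prod_mul_distrib, Finset.prod_const,
    Finset.card_univ, Fintype.card_fin]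
  rw [Finset.prod_ite_zero]
  simp [funext_iff]

/-- The rank one decomposition of a POVM. -/
theorem POVM.exists_frame {I : Type*} [Fintype I] [DecidableEq I] {r : ℕ} (M : POVM I r) :
    ∃ B : Fin r × I → I → ℂ, IsFrame B ∧
      ∀ i x y, M.elem i x y = ∑ z, star (B (i, z) x) * B (i, z) y := by
  choose C hC using fun i => exists_eq_conjTranspose_mul_self (M.posSemidef i)
  have h1 : ∀ i x y, M.elem i x y = ∑ z, star (C i z x) * C i z y := fun i x y => by
    rw [hC i, Matrix.mul_apply]
    rfl
  refine ⟨fun p x => C p.1 p.2 x, fun x y => ?_, h1⟩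
  rw [Fintype.sum_prod_type]
  simp only [← h1]
  rw [← Matrix.sum_apply, M.sum_eq_one, Matrix.one_apply]

/-- The Born probability is a sum over `S` of frame correlations, and the term of `S = ∅` is exactly
the probability for the trivial subgroup. -/
theorem abs_prob_sub_le {H : Subgroup Γ} {t : Γ} (ht : t ≠ 1) (htt : t⁻¹ = t)
    (hH : ∀ u, u ∈ H ↔ u = 1 ∨ u = t) {m r : ℕ} (M : POVM (Fin m → Γ) r)
    {B : Fin r × (Fin m → Γ) → (Fin m → Γ) → ℂ}
    (hB : ∀ i x y, M.elem i x y = ∑ z, star (B (i, z) x) * B (i, z) y) (i : Fin r) :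
    |M.prob (cosetStatePow H m) i - M.prob (cosetStatePow ⊥ m) i| ≤
      (Fintype.card Γ : ℝ)⁻¹ ^ m * ∑ S ∈ Finset.univ.erase (∅ : Finset (Fin m)),
        ∑ z, ‖corr (registerAction S) (B (i, z)) t‖ := by
  have hS : ∀ S : Finset (Fin m), ∑ x, M.elem i (registerAction S t x) x =
      ∑ z, corr (registerAction S) (B (i, z)) t := fun S => by
    simp only [hB, corr]
    rw [Finset.sum_comm]
  have h1 : (M.elem i * cosetStatePow H m).trace = (Fintype.card Γ : ℂ)⁻¹ ^ m *
      ∑ S : Finset (Fin m), ∑ z, corr (registerAction S) (B (i, z)) t := by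
    simp only [← hS, Matrix.trace, Matrix.diag_apply, Matrix.mul_apply,
      cosetStatePow_apply ht htt hH]
    rw [Finset.sum_comm, Finset.sum_comm (s := (Finset.univ : Finset (Finset (Fin m)))),
      Finset.mul_sum]
    refine Finset.sum_congr rfl fun y _ => ?_
    simp only [Finset.mul_sum]
    rw [Finset.sum_comm]
    refine Finset.sum_congr rfl fun S _ => ?_
    rw [Finset.sum_eq_single (registerAction S t y) (fun x _ hx => by simp [hx]) (by simp),
      if_pos rfl]
    ring
  have h0 : registerAction (∅ : Finset (Fin m)) t = 1 := by
    ext x i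
    simp [registerAction_apply]
  have h2 : (M.elem i * cosetStatePow ⊥ m).trace = (Fintype.card Γ : ℂ)⁻¹ ^ m *
      ∑ z, corr (registerAction ∅) (B (i, z)) t := by
    simp only [← hS, Matrix.trace, Matrix.diag_apply, Matrix.mul_apply, cosetStatePow_bot, h0,
      Equiv.Perm.one_apply]
    rw [Finset.mul_sum]
    refine Finset.sum_congr rfl fun y _ => ?_
    rw [Finset.sum_eq_single y (fun x _ hx => by simp [hx.symm]) (by simp), if_pos rfl]
    ring
  have h3 : (M.elem i * cosetStatePow H m).trace - (M.elem i * cosetStatePow ⊥ m).trace =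
      (Fintype.card Γ : ℂ)⁻¹ ^ m * ∑ S ∈ Finset.univ.erase (∅ : Finset (Fin m)),
        ∑ z, corr (registerAction S) (B (i, z)) t := by
    rw [h1, h2, ← mul_sub, ← Finset.add_sum_erase _ _ (Finset.mem_univ (∅ : Finset (Fin m))),
      add_sub_cancel_left]
  rw [POVM.prob, POVM.prob, ← Complex.sub_re, h3]
  refine (Complex.abs_re_le_norm _).trans ?_
  rw [norm_mul, norm_pow, norm_inv, Complex.norm_natCast]
  refine mul_le_mul_of_nonneg_left ?_ (by positivity)
  exact (norm_sum_le _ _).trans (Finset.sum_le_sum fun S _ => norm_sum_le _ _)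

end Registers

/-! ### Distinguishing conjugates from the trivial subgroup -/

section Distinguish

universe u

theorem mem_map_conj_zpowers {Γ : Type*} [Group Γ] {s : Γ} (hs : s * s = 1) (g u : Γ) :
    u ∈ (Subgroup.zpowers s).map (MulAut.conj g).toMonoidHom ↔ u = 1 ∨ u = g * s * g⁻¹ := by
  have hs2 : s ^ 2 = 1 := by rw [sq, hs]
  have hz : ∀ v, v ∈ Subgroup.zpowers s ↔ v = 1 ∨ v = s := by
    intro v
    constructor
    · rintro ⟨k, rfl⟩
      rcases Int.even_or_odd' k with ⟨l, rfl | rfl⟩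
      · left
        simp [zpow_mul, hs2]
      · right
        simp [zpow_add, zpow_mul, hs2]
    · rintro (rfl | rfl)
      · exact one_mem _
      · exact Subgroup.mem_zpowers _
  rw [Subgroup.mem_map]
  constructor
  · rintro ⟨v, hv, rfl⟩
    rcases (hz v).mp hv with rfl | rfl
    · left; simp
    · right; simp
  · rintro (rfl | rfl)
    · exact ⟨1, one_mem _, by simp⟩
    · exact ⟨s, Subgroup.mem_zpowers s, by simp⟩

variable {G : Type u} [Group G] [Fintype G] [DecidableEq G]

/-- The bound on the average correlations of frames of free permutation representations. -/
def CorrelationDecay (h : G) (q : ℝ) : Prop :=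
  ∀ (n : ℕ) (X : Type u) [Fintype X] [DecidableEq X]
    (α : (Fin n → G) →* Equiv.Perm X) (_ : ∀ γ x, α γ x = x → γ = 1)
    (Z : Type u) [Fintype Z] (B : Z → X → ℂ) (_ : IsFrame B),
    ∑ z, ∑ g : Fin n → G, ‖corr α (B z) (g * (fun _ => h) * g⁻¹)‖ ≤
      (Fintype.card G : ℝ) ^ n * Fintype.card X * q ^ n

/-- The conjugate by `g` of the subgroup generated by `(h, …, h)`. -/
abbrev conjSubgroup (h : G) {n : ℕ} (g : Fin n → G) : Subgroup (Fin n → G) :=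
  (Subgroup.zpowers fun _ : Fin n => h).map (MulAut.conj g).toMonoidHom

/-- Each nonempty `S` gives a free action of `G^n`, so correlation decay applies to it; the
normalization `|Γ|^{-m}` cancels the number of basis vectors. -/
theorem sum_abs_prob_sub_le {h : G} (h_inv : orderOf h = 2) {q : ℝ} (hq0 : 0 < q)
    (hq : CorrelationDecay h q) {n : ℕ} (hn : 0 < n) {m k r : ℕ} (hmk : m ≤ k)
    (M : POVM (Fin m → Fin n → G) r) :
    ∑ g : Fin n → G, ∑ i, |M.prob (cosetStatePow (conjSubgroup h g) m) i -
        M.prob (cosetStatePow ⊥ m) i| ≤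
      (Fintype.card G : ℝ) ^ n * (m * (2 ^ k * q ^ n)) := by
  have hh : h * h = 1 := by rw [← sq, ← h_inv, pow_orderOf_eq_one]
  have hne : h ≠ 1 := by
    rintro rfl
    simp at h_inv
  have hs : (fun _ : Fin n => h) * (fun _ : Fin n => h) = 1 := funext fun _ => hh
  have hs1 : (fun _ : Fin n => h) ≠ 1 := fun h1 => hne (congrFun h1 ⟨0, hn⟩)
  have hsinv : (fun _ : Fin n => h)⁻¹ = fun _ => h := inv_eq_of_mul_eq_one_left hs
  obtain ⟨B, hB, hMB⟩ := M.exists_frame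
  set N : ℝ := (Fintype.card G : ℝ) ^ n with hN
  set c : ℝ := (Fintype.card (Fin n → G) : ℝ)⁻¹ ^ m with hc
  have hcX : c * Fintype.card (Fin m → Fin n → G) = 1 := by
    rw [hc, Fintype.card_fun (α := Fin m), Fintype.card_fin, Nat.cast_pow, ← mul_pow,
      inv_mul_cancel₀ (by exact_mod_cast Fintype.card_ne_zero), one_pow]
  have hc0 : 0 ≤ c := by positivity
  have hS : ∀ S ∈ Finset.univ.erase (∅ : Finset (Fin m)),
      ∑ g : Fin n → G, ∑ i, ∑ z, ‖corr (registerAction S) (B (i, z))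
        (g * (fun _ => h) * g⁻¹)‖ ≤ N * Fintype.card (Fin m → Fin n → G) * q ^ n := by
    intro S hS
    have h1 := hq n (Fin m → Fin n → G) (registerAction S)
      (registerAction_free (Finset.nonempty_iff_ne_empty.mpr (Finset.ne_of_mem_erase hS))) _ B hB
    rw [Finset.sum_comm] at h1
    simpa only [Fintype.sum_prod_type] using h1
  -- The factor `m` covers `m = 0`, where there is no nonempty `S`, and makes the bound additive in
  -- the number of coset states.
  have hcard : ((Finset.univ.erase (∅ : Finset (Fin m))).card : ℝ) ≤ m * 2 ^ k := by
    rw [Finset.card_erase_of_mem (Finset.mem_univ _), Finset.card_univ, Fintype.card_finset,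
      Fintype.card_fin]
    rcases Nat.eq_zero_or_pos m with rfl | hm
    · simp
    · have h1 : (2 : ℝ) ^ m ≤ 2 ^ k := pow_le_pow_right₀ (by norm_num) hmk
      have h2 : ((2 ^ m - 1 : ℕ) : ℝ) ≤ 2 ^ m := by
        exact_mod_cast Nat.sub_le _ _
      have h3 : (1 : ℝ) ≤ m := by exact_mod_cast hm
      nlinarith [pow_pos (two_pos : (0 : ℝ) < 2) k]
  calc _ ≤ ∑ g : Fin n → G, ∑ i, c * ∑ S ∈ Finset.univ.erase (∅ : Finset (Fin m)),
        ∑ z, ‖corr (registerAction S) (B (i, z)) (g * (fun _ => h) * g⁻¹)‖ := by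
        refine Finset.sum_le_sum fun g _ => Finset.sum_le_sum fun i _ => ?_
        refine abs_prob_sub_le ?_ ?_ (mem_map_conj_zpowers hs g) M hMB i
        · rwa [Ne, conj_eq_one_iff]
        · rw [conj_inv, hsinv]
    _ = c * ∑ S ∈ Finset.univ.erase (∅ : Finset (Fin m)), ∑ g : Fin n → G, ∑ i, ∑ z,
          ‖corr (registerAction S) (B (i, z)) (g * (fun _ => h) * g⁻¹)‖ := by
        simp only [← Finset.mul_sum]
        congr 1
        rw [Finset.sum_comm]
        simp only [Finset.sum_comm (s := Finset.univ.erase (∅ : Finset (Fin m)))]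
        exact Finset.sum_comm
    _ ≤ c * ∑ S ∈ Finset.univ.erase (∅ : Finset (Fin m)),
          N * Fintype.card (Fin m → Fin n → G) * q ^ n :=
        mul_le_mul_of_nonneg_left (Finset.sum_le_sum hS) hc0
    _ = (Finset.univ.erase (∅ : Finset (Fin m))).card * (N * q ^ n) := by
        rw [Finset.sum_const, nsmul_eq_mul]
        calc _ = (c * Fintype.card (Fin m → Fin n → G)) *
            ((Finset.univ.erase (∅ : Finset (Fin m))).card * (N * q ^ n)) := by ring
          _ = _ := by rw [hcX, one_mul]
    _ ≤ (m * 2 ^ k) * (N * q ^ n) := mul_le_mul_of_nonneg_right hcard (by positivity)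
    _ = _ := by ring

/-- Hybrid argument by induction on the decision tree: the errors of the successive measurements add
up. -/
theorem sum_abs_acceptProb_sub_le {h : G} (h_inv : orderOf h = 2) {q : ℝ} (hq0 : 0 < q)
    (hq : CorrelationDecay h q) {n : ℕ} (hn : 0 < n) {k : ℕ} (A : CosetAlgorithm (Fin n → G))
    (hA : A.IsEntangledAtMost k) :
    ∑ g : Fin n → G, |A.acceptProb (conjSubgroup h g) - A.acceptProb ⊥| ≤
      (Fintype.card G : ℝ) ^ n * (A.numStates * (2 ^ k * q ^ n)) := by
  induction A with
  | halt b => simp [CosetAlgorithm.acceptProb, CosetAlgorithm.numStates]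
  | measure m r M next ih =>
    obtain ⟨hm, hnext⟩ := hA
    set s : ℕ := Finset.univ.sup fun i => (next i).numStates with hs
    set N : ℝ := (Fintype.card G : ℝ) ^ n with hN
    set ε : ℝ := 2 ^ k * q ^ n with hε
    have hε0 : 0 ≤ ε := by positivity
    have hN0 : 0 ≤ N := by positivity
    have hp0 := M.prob_nonneg (cosetStatePow_posSemidef (⊥ : Subgroup (Fin n → G)) m)
    have hstep : ∀ g : Fin n → G,
        |(CosetAlgorithm.measure m r M next).acceptProb (conjSubgroup h g) -
          (CosetAlgorithm.measure m r M next).acceptProb ⊥| ≤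
        ∑ i, |M.prob (cosetStatePow (conjSubgroup h g) m) i - M.prob (cosetStatePow ⊥ m) i| +
        ∑ i, M.prob (cosetStatePow ⊥ m) i *
          |(next i).acceptProb (conjSubgroup h g) - (next i).acceptProb ⊥| := by
      intro g
      rw [CosetAlgorithm.acceptProb, CosetAlgorithm.acceptProb, ← Finset.sum_sub_distrib,
        ← Finset.sum_add_distrib]
      refine (Finset.abs_sum_le_sum_abs _ _).trans (Finset.sum_le_sum fun i _ => ?_)
      obtain ⟨h0, h1⟩ := (next i).acceptProb_mem (conjSubgroup h g)
      set p := M.prob (cosetStatePow (conjSubgroup h g) m) i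
      set p' := M.prob (cosetStatePow ⊥ m) i
      set a := (next i).acceptProb (conjSubgroup h g)
      set a' := (next i).acceptProb ⊥
      -- The weight `p'` left on the later error belongs to the trivial subgroup, so it does not
      -- depend on `g` and the induction hypothesis applies after summing over `g`.
      calc |p * a - p' * a'| = |(p - p') * a + p' * (a - a')| := by congr 1; ring
        _ ≤ |(p - p') * a| + |p' * (a - a')| := abs_add_le _ _
        _ ≤ _ := by
          rw [abs_mul, abs_mul, abs_of_nonneg h0, abs_of_nonneg (hp0 i)]
          exact add_le_add_left (mul_le_of_le_one_right (abs_nonneg _) h1) _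
    have hrest : ∑ g : Fin n → G, ∑ i, M.prob (cosetStatePow ⊥ m) i *
          |(next i).acceptProb (conjSubgroup h g) - (next i).acceptProb ⊥| ≤ N * (s * ε) := by
      rw [Finset.sum_comm]
      simp only [← Finset.mul_sum]
      calc _ ≤ ∑ i, M.prob (cosetStatePow (⊥ : Subgroup (Fin n → G)) m) i * (N * (s * ε)) := by
            refine Finset.sum_le_sum fun i _ => mul_le_mul_of_nonneg_left ?_ (hp0 i)
            refine (ih i (hnext i)).trans ?_
            have h1 : (next i).numStates ≤ s :=
              Finset.le_sup (f := fun i => (next i).numStates) (Finset.mem_univ i)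
            have h2 : ((next i).numStates : ℝ) ≤ s := by exact_mod_cast h1
            gcongr
        _ = _ := by rw [← Finset.sum_mul, M.sum_prob (trace_cosetStatePow _ _), one_mul]
    have hnum : (CosetAlgorithm.measure m r M next).numStates = m + s := rfl
    rw [hnum, Nat.cast_add]
    calc _ ≤ _ := Finset.sum_le_sum fun g _ => hstep g
      _ ≤ N * (m * ε) + N * (s * ε) := by
        rw [Finset.sum_add_distrib]
        exact add_le_add (sum_abs_prob_sub_le h_inv hq0 hq hn hm M) hrest
      _ = _ := by ring

/-- An advantage for every conjugate is in particular an advantage on average over `g`. -/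
theorem le_of_distinguishes {h : G} (h_inv : orderOf h = 2) {q : ℝ} (hq0 : 0 < q)
    (hq : CorrelationDecay h q) {n : ℕ} (hn : 0 < n) {k : ℕ} (A : CosetAlgorithm (Fin n → G))
    (hA : A.IsEntangledAtMost k) {δ : ℝ}
    (hd : A.Distinguishes (Subgroup.zpowers fun _ : Fin n => h) δ) :
    δ ≤ A.numStates * (2 ^ k * q ^ n) := by
  have h1 := sum_abs_acceptProb_sub_le h_inv hq0 hq hn A hA
  have hN : (0 : ℝ) < (Fintype.card G : ℝ) ^ n := pow_pos (by exact_mod_cast Fintype.card_pos) n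
  have h2 : ∑ _g : Fin n → G, δ ≤
      ∑ g : Fin n → G, |A.acceptProb (conjSubgroup h g) - A.acceptProb ⊥| := by
    refine Finset.sum_le_sum fun g _ => le_trans ?_ (le_abs_self _)
    have := hd g
    simp only [conjSubgroup]
    linarith
  rw [Finset.sum_const, Finset.card_univ, Fintype.card_fun, Fintype.card_fin, nsmul_eq_mul,
    Nat.cast_pow] at h2
  exact le_of_mul_le_mul_left (h2.trans h1) hN

end Distinguish

end CosetStates

end

/-! ### From exponential decay to the linear lower bound -/

theorem mainTheorem10 {G : Type*} [Group G] [Fintype G] [DecidableEq G]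
    (h : G) (h_inv : orderOf h = 2)
    (hG : (∑ σ ∈ CosetStates.lambdaSet h, σ.dim ^ 2) * (∑ ρ : CosetStates.Irrep G, ρ.dim)
      < Fintype.card G) :
    ∃ c : ℝ, 0 < c ∧ ∀ a : ℕ, ∀ᶠ n : ℕ in Filter.atTop,
      ∀ (k : ℕ) (A : CosetStates.CosetAlgorithm (Fin n → G)),
        A.IsEntangledAtMost k →
        A.numStates ≤ n ^ a →
        A.Distinguishes (Subgroup.zpowers (fun _ : Fin n => h)) (1 / (n : ℝ) ^ a) →
        c * (n : ℝ) ≤ (k : ℝ) := by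
  obtain ⟨q, hq0, hq1, hq⟩ :=
    CosetStates.exists_sum_corr_le h_inv (CosetStates.conjProducts_not_comm h_inv hG)
  have hlog2 : 0 < Real.log 2 := Real.log_pos one_lt_two
  set l : ℝ := -Real.log q / 2 with hl
  have hl0 : 0 < l := by
    have := Real.log_neg hq0 hq1
    rw [hl]; linarith
  -- With `q^n = e^{-2ln}`, `k < cn` gives `2^k ≤ e^{ln}`: half of the decay pays for the sets of
  -- registers, the other half beats `n^{2a}`.
  refine ⟨l / Real.log 2, div_pos hl0 hlog2, fun a => ?_⟩
  have hr1 : |Real.exp (-l)| < 1 := by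
    rw [abs_of_pos (Real.exp_pos _), Real.exp_lt_one_iff]
    linarith
  have hlim := tendsto_pow_const_mul_const_pow_of_abs_lt_one (2 * a) hr1
  filter_upwards [hlim.eventually (gt_mem_nhds one_pos), Filter.eventually_gt_atTop 0]
    with n hn hn0 k A hA hnum hd
  by_contra! hk
  have h1 := CosetStates.le_of_distinguishes h_inv hq0 hq hn0 A hA hd
  have hn1 : (0 : ℝ) < n := by exact_mod_cast hn0
  have hna : (0 : ℝ) < (n : ℝ) ^ a := pow_pos hn1 a
  have h2 : (2 : ℝ) ^ k ≤ Real.exp (n * l) := by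
    rw [div_mul_eq_mul_div, lt_div_iff₀ hlog2] at hk
    rw [← Real.exp_log (pow_pos (two_pos : (0 : ℝ) < 2) k), Real.log_pow, Real.exp_le_exp]
    linarith
  have h3 : q ^ n = Real.exp (n * (-l)) * Real.exp (n * (-l)) := by
    rw [← Real.exp_add, ← Real.exp_log (pow_pos hq0 n), Real.log_pow, hl]
    congr 1
    ring
  have h4 : (2 : ℝ) ^ k * q ^ n ≤ Real.exp (-l) ^ n := by
    rw [h3, ← Real.exp_nat_mul, ← mul_assoc]
    refine mul_le_of_le_one_left (Real.exp_pos _).le ?_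
    calc _ ≤ Real.exp (n * l) * Real.exp (n * (-l)) :=
          mul_le_mul_of_nonneg_right h2 (Real.exp_pos _).le
      _ = 1 := by rw [← Real.exp_add, mul_neg, add_neg_cancel, Real.exp_zero]
  have h5 : (A.numStates : ℝ) ≤ (n : ℝ) ^ a := by exact_mod_cast hnum
  have h6 : 1 / (n : ℝ) ^ a ≤ (n : ℝ) ^ a * Real.exp (-l) ^ n :=
    h1.trans (mul_le_mul h5 h4 (by positivity) hna.le)
  rw [div_le_iff₀ hna] at h6
  have h7 : (n : ℝ) ^ a * Real.exp (-l) ^ n * (n : ℝ) ^ a =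
      (n : ℝ) ^ (2 * a) * Real.exp (-l) ^ n := by
    rw [two_mul, pow_add]; ring
  linarith
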